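/- Let $G$ be a (discrete) group. A $G$-category is a category $\mathscr C$ with endofunctors $g\cdot$ ($g\in G$) such that strictly $(e\cdot)=\mathrm{id}$ and $(g\cdot)\circ(h\cdot)=(gh)\cdot$; for $H\le G$, $\mathscr C^H$ is the subcategory of objects and morphisms fixed by $H$. Let $\widetilde G$ be the category with object set $G$ and exactly one morphism between any two objects, with $G$ acting by left translation, and let $\mathrm{Cat}(\widetilde G,\mathscr C)$ be the $G$-category of all functors and natural transformations, with the conjugation action $(gF)(x)=gF(g^{-1}x)$, $(g\eta)_x=g\,\eta_{g^{-1}x}$. The homotopy fixed points are $\mathscr C^{hH}=\mathrm{Cat}(\widetilde G,\mathscr C)^H$. A functor $\Theta\colon\mathscr C\to\mathscr D$ of $G$-categories is pseudo equivariant if it comes with natural isomorphisms $\theta_g\colon\Theta(g\,\cdot)\cong g\,\Theta(\cdot)$ with $\theta_e=\mathrm{id}$ and $\theta_{gh}(C)=g\theta_h(C)\circ\theta_g(hC)$. A strictly equivariant functor $F$ is a weak $G$-equivalence if $BF$ restricts to a weak homotopy equivalence $(B\mathscr C)^H\to(B\mathscr D)^H$ for every subgroup $H\le G$, where $B$ is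 the classifying space. A $G$-ring is a (unital, associative) ring with an action of $G$ by ring automorphisms. For a $G$-ring $R$, $G$ acts on the category $\mathrm{Mod}(R)$ of left $R$-modules: $gM$ is the abelian group $M$ with scalar multiplication $r\cdot_g m=(g^{-1}r)m$, and $gf=f$ as a map of abelian groups. Let $\mathscr P(R)\subseteq\mathrm{Mod}(R)$ be the full sub-$G$-category of finitely generated projective modules and $\mathrm{iso}\,\mathscr P(R)$ its groupoid of isomorphisms. The equivariant $K$-theory space is the $G$-space $K_G(R)=B(\mathcal T^{-1}\mathcal T)$, where $\mathcal T=\mathrm{Cat}(\widetilde G,\mathrm{iso}\,\mathscr P(R))$ with the pointwise direct sum, and $\mathcal T^{-1}\mathcal T$ is Quillen's category: its objects are pairs $(m,n)$ of objects of $\mathcal T$, and a morphism $(m,n)\to(p,q)$ is a class of triples $(r,\ r\oplus m\to p,\ r\oplus n\to q)$ up to isomorphism of $r$; $G$ acts by $g(m,n)=(gm,gn)$ and $g(r,f,f')=(gr,gf,gf')$. Two $G$-rings $R$ and $S$ are equivariantly Morita equivalent if there is an equivalence of categories $\mathrm{Mod}(R)\to\mathrm{Mod}(S)$ that is pseudo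 equivariant. **Proposition.** Let $R$ and $S$ be $G$-rings that are equivariantly Morita equivalent (where $\mathrm{Mod}$ may be taken to be either the category of all modules or that of finitely generated modules). Then: 1. There is a strictly $G$-equivariant functor $\mathrm{Cat}(\widetilde G,\mathscr P(R))\to\mathrm{Cat}(\widetilde G,\mathscr P(S))$ which is a weak $G$-equivalence and which induces an equivalence of categories $\mathscr P(R)^{hH}\to\mathscr P(S)^{hH}$ for every subgroup $H\le G$. 2. There is a $G$-homotopy equivalence $K_G(R)\simeq K_G(S)$. -/

import Mathlib

open CategoryTheory MonoidalCategory Topology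
open scoped unitInterval

universe w v u v₁ u₁ v₂ u₂

namespace EquivariantK

/-! ## Categories with an action of a (discrete) group -/

/-- A `G`-category: a category `C` with endofunctors `g ·` such that, strictly,
`(e ·) = id` and `(g ·) ∘ (h ·) = (gh) ·`. -/
class GCategory (G : Type w) [Group G] (C : Type u) [Category.{v} C] where
  act : G → C ⥤ C
  act_one : act 1 = 𝟭 C
  act_mul : ∀ g h : G, act (g * h) = act h ⋙ act g

open GCategory

section Basic

variable {G : Type w} [Group G]

theorem act_one_obj {C : Type u} [Category.{v} C] [GCategory G C] (X : C) :
    (act (1 : G)).obj X = X := by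
  rw [act_one]; rfl

theorem act_mul_obj {C : Type u} [Category.{v} C] [GCategory G C] (g h : G) (X : C) :
    (act (g * h)).obj X = (act g).obj ((act h).obj X) := by
  rw [act_mul]; rfl

theorem act_one_map_heq {C : Type u} [Category.{v} C] [GCategory G C] {X Y : C} (f : X ⟶ Y) :
    HEq ((act (1 : G)).map f) f := by
  rw [act_one]; rfl

theorem act_mul_map_heq {C : Type u} [Category.{v} C] [GCategory G C] (g h : G) {X Y : C}
    (f : X ⟶ Y) : HEq ((act (g * h)).map f) ((act g).map ((act h).map f)) := by
  rw [act_mul]; rfl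

end Basic

/-- Strict (on the nose) equivariance of a functor between `G`-categories. -/
def IsEquivariant (G : Type w) [Group G] {C : Type u₁} [Category.{v₁} C] [GCategory G C]
    {D : Type u₂} [Category.{v₂} D] [GCategory G D] (F : C ⥤ D) : Prop :=
  ∀ g : G, act g ⋙ F = F ⋙ act g

/-- A pseudo equivariant functor `Θ : C ⥤ D`: natural isomorphisms
`θ_g : Θ(g -) ≅ g Θ(-)` with `θ_e = id` and `θ_{gh}(X) = g θ_h(X) ∘ θ_g(hX)`.
The `eqToHom`s only identify equal objects. -/
structure PseudoEquivariantFunctor (G : Type w) [Group G]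
    (C : Type u₁) [Category.{v₁} C] [GCategory G C]
    (D : Type u₂) [Category.{v₂} D] [GCategory G D] where
  functor : C ⥤ D
  θ : ∀ g : G, act g ⋙ functor ≅ functor ⋙ act g
  θ_one : ∀ X : C, (θ 1).hom.app X =
    eqToHom (show functor.obj ((act (1 : G)).obj X) = (act (1 : G)).obj (functor.obj X) by
      rw [act_one_obj, act_one_obj])
  θ_mul : ∀ (g h : G) (X : C), (θ (g * h)).hom.app X =
    eqToHom (show functor.obj ((act (g * h)).obj X) = functor.obj ((act g).obj ((act h).obj X)) by
      rw [act_mul_obj]) ≫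
    (θ g).hom.app ((act h).obj X) ≫ (act g).map ((θ h).hom.app X) ≫
    eqToHom (show (act g).obj ((act h).obj (functor.obj X)) = (act (g * h)).obj (functor.obj X) by
      rw [act_mul_obj])

/-! ### Fixed point categories -/

/-- The `H`-fixed point category `C^H`: objects with `hX = X` for all `h ∈ H`. -/
structure FixedCategory {G : Type w} [Group G] (H : Subgroup G) (C : Type u) [Category.{v} C]
    [GCategory G C] where
  obj : C
  fixed : ∀ h ∈ H, (act h).obj obj = obj

/-- The morphisms of `C^H` are the morphisms `f` of `C` with `hf = f` for all `h ∈ H`. -/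
instance {G : Type w} [Group G] (H : Subgroup G) (C : Type u) [Category.{v} C]
    [GCategory G C] : Category (FixedCategory H C) where
  Hom X Y := {f : X.obj ⟶ Y.obj // ∀ h ∈ H, HEq ((act h).map f) f}
  id X := ⟨𝟙 X.obj, fun h hh => by rw [CategoryTheory.Functor.map_id, X.fixed h hh]⟩
  comp {X Y Z} f g := ⟨f.1 ≫ g.1, fun h hh => by
    have key : ∀ {X X' Y Y' Z Z' : C} (_ : X = X') (_ : Y = Y') (_ : Z = Z')
        (a : X ⟶ Y) (a' : X' ⟶ Y') (b : Y ⟶ Z) (b' : Y' ⟶ Z'), HEq a a' → HEq b b' →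
        HEq (a ≫ b) (a' ≫ b') := by
      rintro _ _ _ _ _ _ rfl rfl rfl _ _ _ _ ⟨⟩ ⟨⟩; rfl
    rw [CategoryTheory.Functor.map_comp]
    exact key (X.fixed h hh) (Y.fixed h hh) (Z.fixed h hh) _ _ _ _ (f.2 h hh) (g.2 h hh)⟩
  id_comp f := Subtype.ext (Category.id_comp f.1)
  comp_id f := Subtype.ext (Category.comp_id f.1)
  assoc f g h := Subtype.ext (Category.assoc f.1 g.1 h.1)

/-- The functor `F^H : C^H ⥤ D^H` induced by an equivariant functor `F : C ⥤ D`. -/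
def fixedFunctor {G : Type w} [Group G] {C : Type u₁} [Category.{v₁} C] [GCategory G C]
    {D : Type u₂} [Category.{v₂} D] [GCategory G D] (F : C ⥤ D) (hF : IsEquivariant G F)
    (H : Subgroup G) : FixedCategory H C ⥤ FixedCategory H D where
  obj X := ⟨F.obj X.obj, fun h hh =>
    (Functor.congr_obj (hF h) X.obj).symm.trans (congrArg F.obj (X.fixed h hh))⟩
  map {X Y} f := ⟨F.map f.1, fun h hh => by
    have key : ∀ {X X' Y Y' : C} (_ : X = X') (_ : Y = Y') (a : X ⟶ Y) (a' : X' ⟶ Y'),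
        HEq a a' → HEq (F.map a) (F.map a') := by
      rintro _ _ _ _ rfl rfl _ _ ⟨⟩; rfl
    have e : HEq ((F ⋙ act h).map f.1) ((act h ⋙ F).map f.1) := by rw [hF h]
    exact e.trans (key (X.fixed h hh) (Y.fixed h hh) _ _ (f.2 h hh))⟩
  map_id X := Subtype.ext (F.map_id X.obj)
  map_comp f g := Subtype.ext (F.map_comp f.1 g.1)

/-! ### The `G`-categories `G̃` and `Cat(G̃, C)` -/

/-- `G̃`: objects the elements of `G`, exactly one morphism between any two objects, `G` acting
by left translation. -/
instance codiscreteGCategory (G : Type w) [Group G] : GCategory G (Codiscrete G) where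
  act g := Codiscrete.functorOfFun (fun x => g * x)
  act_one := Functor.hext (fun X => by
    cases X; simp [Codiscrete.functorOfFun, Codiscrete.functor]) (fun X Y f => by
    cases X; cases Y; simp [Codiscrete.functorOfFun, Codiscrete.functor]; rfl)
  act_mul g h := Functor.hext (fun X => by
    cases X; simp [Codiscrete.functorOfFun, Codiscrete.functor, mul_assoc]) (fun X Y f => by
    cases X; cases Y; simp [Codiscrete.functorOfFun, Codiscrete.functor])

/-- `G` acts on the category of functors and natural transformations `A ⥤ C` by conjugation:
`(gF)(a) = g F(g⁻¹ a)` and `(gη)_a = g η_{g⁻¹ a}`. -/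
instance functorGCategory (G : Type w) [Group G] (A : Type u₁) [Category.{v₁} A] [GCategory G A]
    (C : Type u₂) [Category.{v₂} C] [GCategory G C] : GCategory G (A ⥤ C) where
  act g := (Functor.whiskeringLeft A A C).obj (act g⁻¹) ⋙ (Functor.whiskeringRight A C C).obj (act g)
  act_one := by rw [inv_one, act_one, act_one]; rfl
  act_mul g h := by rw [mul_inv_rev, act_mul, act_mul]; rfl

/-- `Cat(G̃, C)`, with all functors and all natural transformations. -/
abbrev CatTilde (G : Type w) [Group G] (C : Type u) [Category.{v} C] :=
  Codiscrete G ⥤ C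

/-- The maximal subgroupoid `iso C` of a `G`-category. -/
instance coreGCategory (G : Type w) [Group G] (C : Type u) [Category.{v} C] [GCategory G C] :
    GCategory G (Core C) where
  act g := (act g).core
  act_one := by rw [act_one]; rfl
  act_mul g h := by rw [act_mul]; rfl

/-- A full subcategory closed under the action of `G` is a `G`-category. -/
@[reducible]
def fullSubcategoryGCategory (G : Type w) [Group G] {C : Type u} [Category.{v} C] [GCategory G C]
    (P : ObjectProperty C) (hP : ∀ (g : G) (X : C), P X → P ((act g).obj X)) :
    GCategory G P.FullSubcategory where
  act g := P.lift (P.ι ⋙ act g) (fun X => hP g X.obj X.property)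
  act_one := Functor.hext
    (fun X => by
      cases X with
      | mk X hX => simp [ObjectProperty.lift, act_one_obj])
    (fun X Y f => by
      have key : ∀ (X X' Y Y' : C) (hX : P X) (hX' : P X') (hY : P Y) (hY' : P Y')
          (a : X ⟶ Y) (a' : X' ⟶ Y'), X = X' → Y = Y' → HEq a a' →
          HEq (ObjectProperty.homMk a :
              (⟨X, hX⟩ : P.FullSubcategory) ⟶ (⟨Y, hY⟩ : P.FullSubcategory))
            (ObjectProperty.homMk a' :
              (⟨X', hX'⟩ : P.FullSubcategory) ⟶ (⟨Y', hY'⟩ : P.FullSubcategory)) := by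
        rintro _ _ _ _ _ _ _ _ _ _ rfl rfl ⟨⟩; rfl
      exact key _ _ _ _ _ _ _ _ _ _ (act_one_obj _) (act_one_obj _) (act_one_map_heq f.hom))
  act_mul g h := Functor.hext
    (fun X => by
      cases X with
      | mk X hX => simp [ObjectProperty.lift, act_mul_obj])
    (fun X Y f => by
      have key : ∀ (X X' Y Y' : C) (hX : P X) (hX' : P X') (hY : P Y) (hY' : P Y')
          (a : X ⟶ Y) (a' : X' ⟶ Y'), X = X' → Y = Y' → HEq a a' →
          HEq (ObjectProperty.homMk a :
              (⟨X, hX⟩ : P.FullSubcategory) ⟶ (⟨Y, hY⟩ : P.FullSubcategory))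
            (ObjectProperty.homMk a' :
              (⟨X', hX'⟩ : P.FullSubcategory) ⟶ (⟨Y', hY'⟩ : P.FullSubcategory)) := by
        rintro _ _ _ _ _ _ _ _ _ _ rfl rfl ⟨⟩; rfl
      exact key _ _ _ _ _ _ _ _ _ _ (act_mul_obj g h _) (act_mul_obj g h _)
        (act_mul_map_heq g h f.hom))

/-! ## `G`-rings and their modules

A `G`-ring is a ring `R` with `[MulSemiringAction G R]`. -/

/-- The `G`-category `Mod(R)`: `gM` is the abelian group `M` with `r ·_g m = (g⁻¹ r) m`, and `gf` is
`f` as a homomorphism of abelian groups. -/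
noncomputable instance moduleGCategory (G : Type w) [Group G] (R : Type u) [Ring R] [MulSemiringAction G R] :
    GCategory G (ModuleCat.{v} R) where
  act g := ModuleCat.restrictScalars (MulSemiringAction.toRingHom G R g⁻¹)
  act_one := by
    have e : MulSemiringAction.toRingHom G R (1 : G)⁻¹ = RingHom.id R := by ext; simp
    rw [e]; rfl
  act_mul g h := by
    have e : MulSemiringAction.toRingHom G R (g * h)⁻¹ =
        (MulSemiringAction.toRingHom G R h⁻¹).comp (MulSemiringAction.toRingHom G R g⁻¹) := by
      ext; simp [mul_smul]
    rw [e]; rfl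

/-- Finitely generated projective modules, as a property of modules. -/
def isFGProjective (R : Type u) [Ring R] : ObjectProperty (ModuleCat.{v} R) :=
  fun M => Module.Finite R M ∧ Module.Projective R M

/-- The category `P(R)` of finitely generated projective modules and all linear maps. -/
abbrev ProjModuleCat (R : Type u) [Ring R] := (isFGProjective.{v} R).FullSubcategory

theorem finite_act {G : Type w} [Group G] {R : Type u} [Ring R] [MulSemiringAction G R] (g : G)
    (M : ModuleCat.{v} R) (hM : Module.Finite R M) :
    Module.Finite R ((act g).obj M : ModuleCat.{v} R) := by
  let e := MulSemiringAction.toRingEquiv G R g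
  let N : ModuleCat.{v} R := (act g).obj M
  let f : M →ₛₗ[(e : R →+* R)] N :=
    { toFun := fun m => m
      map_add' := fun _ _ => rfl
      map_smul' := fun r m => by
        change r • m = (g⁻¹ • (g • r)) • m
        rw [inv_smul_smul] }
  exact Module.Finite.of_surjective f (fun m => ⟨m, rfl⟩)

theorem projective_act {G : Type w} [Group G] {R : Type u} [Ring R] [MulSemiringAction G R] (g : G)
    (M : ModuleCat.{v} R) (hM : Module.Projective R M) :
    Module.Projective R ((act g).obj M : ModuleCat.{v} R) := by
  let e := MulSemiringAction.toRingEquiv G R g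
  let N : ModuleCat.{v} R := (act g).obj M
  let _ : RingHomInvPair (e : R →+* R) (e.symm : R →+* R) := RingHomInvPair.of_ringEquiv e
  let _ : RingHomInvPair (e.symm : R →+* R) (e : R →+* R) := RingHomInvPair.of_ringEquiv e.symm
  let f : LinearEquiv (σ' := (e.symm : R →+* R)) (e : R →+* R) M N :=
    { toFun := fun m => m
      invFun := fun m => m
      left_inv := fun _ => rfl
      right_inv := fun _ => rfl
      map_add' := fun _ _ => rfl
      map_smul' := fun r m => by
        change r • m = (g⁻¹ • (g • r)) • m
        rw [inv_smul_smul] }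
  exact Module.Projective.of_equiv f

noncomputable instance projGCategory (G : Type w) [Group G] (R : Type u) [Ring R]
    [MulSemiringAction G R] : GCategory G (ProjModuleCat.{v} R) :=
  fullSubcategoryGCategory G (isFGProjective R)
    (fun g M hM => ⟨finite_act g M hM.1, projective_act g M hM.2⟩)

noncomputable instance fgGCategory (G : Type w) [Group G] (R : Type u) [Ring R]
    [MulSemiringAction G R] : GCategory G (FGModuleCat.{v} R) :=
  fullSubcategoryGCategory G (ModuleCat.isFG R) (fun g M hM => finite_act g M hM)

/-- The direct sum `M ⊕ N`, on the product `M × N`. -/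
def dirSum {R : Type u} [Ring R] (M N : ProjModuleCat.{v} R) : ProjModuleCat.{v} R where
  obj := ModuleCat.of R (M.obj × N.obj)
  property := by
    have := M.property.1
    have := M.property.2
    have := N.property.1
    have := N.property.2
    exact ⟨inferInstanceAs (Module.Finite R (M.obj × N.obj)),
      inferInstanceAs (Module.Projective R (M.obj × N.obj))⟩

/-- The zero module. -/
def zeroModule (R : Type u) [Ring R] : ProjModuleCat.{v} R where
  obj := ModuleCat.of R PUnit.{v + 1}
  property := ⟨inferInstanceAs (Module.Finite R PUnit.{v + 1}),
    inferInstanceAs (Module.Projective R PUnit.{v + 1})⟩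

/-- The isomorphism of `P(R)` given by a linear equivalence. -/
def isoOfLinearEquiv {R : Type u} [Ring R] {M N : ProjModuleCat.{v} R} (e : M.obj ≃ₗ[R] N.obj) :
    M ≅ N where
  hom := ObjectProperty.homMk (ModuleCat.ofHom e.toLinearMap)
  inv := ObjectProperty.homMk (ModuleCat.ofHom e.symm.toLinearMap)
  hom_inv_id := by ext x; exact e.symm_apply_apply x
  inv_hom_id := by ext x; exact e.apply_symm_apply x

/-- The direct sum of homomorphisms. -/
def dirSumMap {R : Type u} [Ring R] {M M' N N' : ProjModuleCat.{v} R} (f : M ⟶ M') (f' : N ⟶ N') :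
    dirSum M N ⟶ dirSum M' N' :=
  ObjectProperty.homMk (ModuleCat.ofHom (LinearMap.prodMap f.hom.hom f'.hom.hom))

instance (R : Type u) [Ring R] : MonoidalCategoryStruct (ProjModuleCat.{v} R) where
  tensorObj := dirSum
  tensorHom := dirSumMap
  whiskerLeft M _ _ f := dirSumMap (𝟙 M) f
  whiskerRight f N := dirSumMap f (𝟙 N)
  tensorUnit := zeroModule R
  associator L M N := isoOfLinearEquiv (LinearEquiv.prodAssoc R L.obj M.obj N.obj)
  leftUnitor M := isoOfLinearEquiv (LinearEquiv.uniqueProd (M := M.obj) (M₂ := PUnit.{v + 1}))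
  rightUnitor M := isoOfLinearEquiv (LinearEquiv.prodUnique (M := M.obj) (M₂ := PUnit.{v + 1}))

/-- `P(R)` is monoidal under direct sum (so `⊗` is `⊕` here). -/
instance (R : Type u) [Ring R] : MonoidalCategory (ProjModuleCat.{v} R) :=
  MonoidalCategory.ofTensorHom
    (id_tensorHom_id := fun _ _ => rfl)
    (id_tensorHom := fun _ _ _ _ => rfl)
    (tensorHom_id := fun _ _ => rfl)
    (tensorHom_comp_tensorHom := fun _ _ _ _ => rfl)
    (associator_naturality := fun _ _ _ => rfl)
    (leftUnitor_naturality := fun _ => rfl)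
    (rightUnitor_naturality := fun _ => rfl)
    (pentagon := fun _ _ _ _ => rfl)
    (triangle := fun _ _ => rfl)

/-! ## Monoidal `G`-categories and the category `S⁻¹S` -/

/-- `G` acts on a monoidal category through strict monoidal functors. -/
class IsMonoidalGCategory (G : Type w) [Group G] (C : Type u) [Category.{v} C]
    [MonoidalCategory C] [GCategory G C] : Prop where
  act_tensorObj : ∀ (g : G) (X Y : C), (act g).obj (X ⊗ Y) = (act g).obj X ⊗ (act g).obj Y
  act_tensorUnit : ∀ g : G, (act g).obj (𝟙_ C) = 𝟙_ C
  act_tensorHom : ∀ (g : G) {X X' Y Y' : C} (f : X ⟶ X') (f' : Y ⟶ Y'),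
    HEq ((act g).map (f ⊗ₘ f')) ((act g).map f ⊗ₘ (act g).map f')
  act_associator : ∀ (g : G) (X Y Z : C),
    HEq ((act g).map (α_ X Y Z).hom) (α_ ((act g).obj X) ((act g).obj Y) ((act g).obj Z)).hom
  act_leftUnitor : ∀ (g : G) (X : C), HEq ((act g).map (λ_ X).hom) (λ_ ((act g).obj X)).hom
  act_rightUnitor : ∀ (g : G) (X : C), HEq ((act g).map (ρ_ X).hom) (ρ_ ((act g).obj X)).hom

instance (G : Type w) [Group G] (R : Type u) [Ring R] [MulSemiringAction G R] :
    IsMonoidalGCategory G (ProjModuleCat.{v} R) where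
  act_tensorObj _ _ _ := rfl
  act_tensorUnit _ := rfl
  act_tensorHom _ _ _ _ _ _ _ := HEq.rfl
  act_associator _ _ _ _ := HEq.rfl
  act_leftUnitor _ _ := HEq.rfl
  act_rightUnitor _ _ := HEq.rfl

/-! ### `iso C` and `Cat(A, C)` as monoidal `G`-categories -/

instance {C : Type u} [Category.{v} C] [MonoidalCategory C] : MonoidalCategoryStruct (Core C) where
  tensorObj X Y := ⟨X.of ⊗ Y.of⟩
  tensorHom f f' := ⟨f.iso ⊗ᵢ f'.iso⟩
  whiskerLeft X _ _ f := ⟨whiskerLeftIso X.of f.iso⟩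
  whiskerRight f Y := ⟨whiskerRightIso f.iso Y.of⟩
  tensorUnit := ⟨𝟙_ C⟩
  associator X Y Z := Core.isoMk (α_ X.of Y.of Z.of)
  leftUnitor X := Core.isoMk (λ_ X.of)
  rightUnitor X := Core.isoMk (ρ_ X.of)

/-- The monoidal structure on `iso C` inherited from `C`. -/
instance {C : Type u} [Category.{v} C] [MonoidalCategory C] : MonoidalCategory (Core C) :=
  MonoidalCategory.ofTensorHom
    (id_tensorHom_id := fun X Y => Core.hom_ext (id_tensorHom_id X.of Y.of))
    (id_tensorHom := fun X _ _ f => Core.hom_ext (id_tensorHom X.of f.iso.hom))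
    (tensorHom_id := fun f Y => Core.hom_ext (tensorHom_id f.iso.hom Y.of))
    (tensorHom_comp_tensorHom := fun f₁ f₂ g₁ g₂ => Core.hom_ext
      (MonoidalCategory.tensorHom_comp_tensorHom f₁.iso.hom f₂.iso.hom g₁.iso.hom g₂.iso.hom))
    (associator_naturality := fun f₁ f₂ f₃ => Core.hom_ext
      (MonoidalCategory.associator_naturality f₁.iso.hom f₂.iso.hom f₃.iso.hom))
    (leftUnitor_naturality := fun f => Core.hom_ext
      (show (𝟙 (𝟙_ C) ⊗ₘ f.iso.hom) ≫ _ = _ by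
        rw [id_tensorHom]; exact MonoidalCategory.leftUnitor_naturality f.iso.hom))
    (rightUnitor_naturality := fun f => Core.hom_ext
      (show (f.iso.hom ⊗ₘ 𝟙 (𝟙_ C)) ≫ _ = _ by
        rw [tensorHom_id]; exact MonoidalCategory.rightUnitor_naturality f.iso.hom))
    (pentagon := fun W X Y Z => Core.hom_ext
      (show ((α_ W.of X.of Y.of).hom ⊗ₘ 𝟙 Z.of) ≫ (α_ W.of (X.of ⊗ Y.of) Z.of).hom ≫
          (𝟙 W.of ⊗ₘ (α_ X.of Y.of Z.of).hom) =
          (α_ (W.of ⊗ X.of) Y.of Z.of).hom ≫ (α_ W.of X.of (Y.of ⊗ Z.of)).hom by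
        rw [id_tensorHom, tensorHom_id]
        exact MonoidalCategory.pentagon W.of X.of Y.of Z.of))
    (triangle := fun X Y => Core.hom_ext
      (show (α_ X.of (𝟙_ C) Y.of).hom ≫ (𝟙 X.of ⊗ₘ (λ_ Y.of).hom) =
          ((ρ_ X.of).hom ⊗ₘ 𝟙 Y.of) by
        rw [id_tensorHom, tensorHom_id]; exact MonoidalCategory.triangle X.of Y.of))

theorem core_hom_heq {C : Type u} [Category.{v} C] {X X' Y Y' : C} (hX : X = X') (hY : Y = Y')
    (f : (⟨X⟩ : Core C) ⟶ ⟨Y⟩) (f' : (⟨X'⟩ : Core C) ⟶ ⟨Y'⟩)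
    (h : HEq f.iso.hom f'.iso.hom) : HEq f f' := by
  subst hX hY
  exact heq_of_eq (Core.hom_ext (eq_of_heq h))

theorem act_tensorObj_left {G : Type w} [Group G] {C : Type u} [Category.{v} C]
    [MonoidalCategory C] [GCategory G C] [IsMonoidalGCategory G C] (g : G) (X Y Z : C) :
    (act g).obj ((X ⊗ Y) ⊗ Z) = ((act g).obj X ⊗ (act g).obj Y) ⊗ (act g).obj Z := by
  rw [IsMonoidalGCategory.act_tensorObj, IsMonoidalGCategory.act_tensorObj]

theorem act_tensorObj_right {G : Type w} [Group G] {C : Type u} [Category.{v} C]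
    [MonoidalCategory C] [GCategory G C] [IsMonoidalGCategory G C] (g : G) (X Y Z : C) :
    (act g).obj (X ⊗ Y ⊗ Z) = (act g).obj X ⊗ (act g).obj Y ⊗ (act g).obj Z := by
  rw [IsMonoidalGCategory.act_tensorObj, IsMonoidalGCategory.act_tensorObj]

theorem act_unit_tensor {G : Type w} [Group G] {C : Type u} [Category.{v} C]
    [MonoidalCategory C] [GCategory G C] [IsMonoidalGCategory G C] (g : G) (X : C) :
    (act g).obj (𝟙_ C ⊗ X) = 𝟙_ C ⊗ (act g).obj X := by
  rw [IsMonoidalGCategory.act_tensorObj, IsMonoidalGCategory.act_tensorUnit]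

theorem act_tensor_unit {G : Type w} [Group G] {C : Type u} [Category.{v} C]
    [MonoidalCategory C] [GCategory G C] [IsMonoidalGCategory G C] (g : G) (X : C) :
    (act g).obj (X ⊗ 𝟙_ C) = (act g).obj X ⊗ 𝟙_ C := by
  rw [IsMonoidalGCategory.act_tensorObj, IsMonoidalGCategory.act_tensorUnit]

instance (G : Type w) [Group G] (C : Type u) [Category.{v} C] [MonoidalCategory C] [GCategory G C]
    [IsMonoidalGCategory G C] : IsMonoidalGCategory G (Core C) where
  act_tensorObj g X Y := congrArg Core.mk (IsMonoidalGCategory.act_tensorObj g X.of Y.of)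
  act_tensorUnit g := congrArg Core.mk (IsMonoidalGCategory.act_tensorUnit g)
  act_tensorHom g _ _ _ _ f f' := core_hom_heq
    (IsMonoidalGCategory.act_tensorObj _ _ _) (IsMonoidalGCategory.act_tensorObj _ _ _) _ _
    (IsMonoidalGCategory.act_tensorHom g f.iso.hom f'.iso.hom)
  act_associator g X Y Z := core_hom_heq
    (act_tensorObj_left g X.of Y.of Z.of) (act_tensorObj_right g X.of Y.of Z.of) _ _
    (IsMonoidalGCategory.act_associator g X.of Y.of Z.of)
  act_leftUnitor g X := core_hom_heq (act_unit_tensor g X.of) rfl _ _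
    (IsMonoidalGCategory.act_leftUnitor g X.of)
  act_rightUnitor g X := core_hom_heq (act_tensor_unit g X.of) rfl _ _
    (IsMonoidalGCategory.act_rightUnitor g X.of)

theorem natTrans_heq {A : Type u₁} [Category.{v₁} A] {C : Type u₂} [Category.{v₂} C]
    {F F' K K' : A ⥤ C} (hF : F = F') (hK : K = K') (α : F ⟶ K) (β : F' ⟶ K')
    (h : ∀ X, HEq (α.app X) (β.app X)) : HEq α β := by
  subst hF hK
  exact heq_of_eq (NatTrans.ext (funext fun X => eq_of_heq (h X)))

section FunctorMonoidal

variable (G : Type w) [Group G] (A : Type u₁) [Category.{v₁} A] [GCategory G A]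
  (C : Type u₂) [Category.{v₂} C] [MonoidalCategory C] [GCategory G C] [IsMonoidalGCategory G C]

theorem functor_act_tensorObj (g : G) (F K : A ⥤ C) :
    (act g).obj (F ⊗ K) = (act g).obj F ⊗ (act g).obj K :=
  Functor.hext (fun _ => IsMonoidalGCategory.act_tensorObj g _ _)
    (fun _ _ _ => IsMonoidalGCategory.act_tensorHom g _ _)

theorem functor_act_tensorUnit (g : G) : (act g).obj (𝟙_ (A ⥤ C)) = 𝟙_ (A ⥤ C) :=
  Functor.hext (fun _ => IsMonoidalGCategory.act_tensorUnit g)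
    (fun _ _ _ => by
      change HEq ((act g).map (𝟙 (𝟙_ C))) (𝟙 (𝟙_ C))
      rw [CategoryTheory.Functor.map_id, IsMonoidalGCategory.act_tensorUnit])

/-- The pointwise monoidal structure on functors is preserved strictly by conjugation. -/
instance : IsMonoidalGCategory G (A ⥤ C) where
  act_tensorObj := functor_act_tensorObj G A C
  act_tensorUnit := functor_act_tensorUnit G A C
  act_tensorHom g _ _ _ _ _ _ := natTrans_heq (functor_act_tensorObj G A C _ _ _)
    (functor_act_tensorObj G A C _ _ _) _ _ (fun _ => IsMonoidalGCategory.act_tensorHom g _ _)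
  act_associator g _ _ _ := natTrans_heq
    (by simp only [functor_act_tensorObj])
    (by simp only [functor_act_tensorObj]) _ _
    (fun _ => IsMonoidalGCategory.act_associator g _ _ _)
  act_leftUnitor g _ := natTrans_heq
    (by simp only [functor_act_tensorObj, functor_act_tensorUnit]) rfl _ _
    (fun _ => IsMonoidalGCategory.act_leftUnitor g _)
  act_rightUnitor g _ := natTrans_heq
    (by simp only [functor_act_tensorObj, functor_act_tensorUnit]) rfl _ _
    (fun _ => IsMonoidalGCategory.act_rightUnitor g _)

end FunctorMonoidal

/-! ### Quillen's category `S⁻¹S` -/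

/-- The objects of `S⁻¹S` are the pairs `(m, n)` of objects of `S`. -/
structure GroupCompletion (S : Type u) where
  fst : S
  snd : S

namespace GroupCompletion

theorem mk_eq {S : Type u} {a b c d : S} (h : a = c) (h' : b = d) :
    (⟨a, b⟩ : GroupCompletion S) = ⟨c, d⟩ := by
  rw [h, h']

section Category

variable {S : Type u} [Category.{v} S] [MonoidalCategory S]

/-- A triple `(r, r ⊕ m ⟶ p, r ⊕ n ⟶ q)`. -/
structure Triple (X Y : GroupCompletion S) where
  r : S
  f : r ⊗ X.fst ⟶ Y.fst
  f' : r ⊗ X.snd ⟶ Y.snd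

/-- Two triples are equivalent if an isomorphism of the first entries is compatible with the
other entries. -/
def Triple.Rel {X Y : GroupCompletion S} (a b : Triple X Y) : Prop :=
  ∃ e : a.r ≅ b.r, e.hom ▷ X.fst ≫ b.f = a.f ∧ e.hom ▷ X.snd ≫ b.f' = a.f'

instance tripleSetoid (X Y : GroupCompletion S) : Setoid (Triple X Y) where
  r := Triple.Rel
  iseqv :=
    { refl := fun a => ⟨Iso.refl _, by simp, by simp⟩
      symm := by
        rintro a b ⟨e, h, h'⟩
        refine ⟨e.symm, ?_, ?_⟩
        · rw [← h]; simp
        · rw [← h']; simp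
      trans := by
        rintro a b c ⟨e, h, h'⟩ ⟨d, k, k'⟩
        refine ⟨e ≪≫ d, ?_, ?_⟩
        · rw [← h, ← k]; simp
        · rw [← h', ← k']; simp }

/-- The identity triple `(0, 0 ⊕ m ≅ m, 0 ⊕ n ≅ n)`. -/
def Triple.id (X : GroupCompletion S) : Triple X X :=
  ⟨𝟙_ S, (λ_ X.fst).hom, (λ_ X.snd).hom⟩

/-- The composite of `(r, f, f')` followed by `(s, k, k')` is
`(s ⊕ r, k ∘ (s ⊕ f), k' ∘ (s ⊕ f'))`. -/
def Triple.comp {X Y Z : GroupCompletion S} (a : Triple X Y) (b : Triple Y Z) : Triple X Z :=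
  ⟨b.r ⊗ a.r, (α_ b.r a.r X.fst).hom ≫ b.r ◁ a.f ≫ b.f,
    (α_ b.r a.r X.snd).hom ≫ b.r ◁ a.f' ≫ b.f'⟩

instance : Category (GroupCompletion S) where
  Hom X Y := Quotient (tripleSetoid X Y)
  id X := ⟦Triple.id X⟧
  comp := Quotient.map₂ Triple.comp (by
    rintro a₁ a₂ ⟨e, h, h'⟩ b₁ b₂ ⟨d, k, k'⟩
    refine ⟨d ⊗ᵢ e, ?_, ?_⟩
    · simp only [Triple.comp, ← h, ← k, tensorIso_hom, MonoidalCategory.whiskerLeft_comp,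
        Category.assoc]
      rw [MonoidalCategory.whisker_exchange_assoc, MonoidalCategory.tensorHom_def']
      simp
    · simp only [Triple.comp, ← h', ← k', tensorIso_hom, MonoidalCategory.whiskerLeft_comp,
        Category.assoc]
      rw [MonoidalCategory.whisker_exchange_assoc, MonoidalCategory.tensorHom_def']
      simp)
  id_comp := by
    rintro X Y ⟨a⟩
    refine Quotient.sound ⟨ρ_ a.r, ?_, ?_⟩ <;> simp [Triple.comp, Triple.id]
  comp_id := by
    rintro X Y ⟨a⟩
    refine Quotient.sound ⟨λ_ a.r, ?_, ?_⟩ <;> simp [Triple.comp, Triple.id]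
  assoc := by
    rintro W X Y Z ⟨a⟩ ⟨b⟩ ⟨c⟩
    refine Quotient.sound ⟨(α_ c.r b.r a.r).symm, ?_, ?_⟩ <;> simp [Triple.comp]

end Category

section Action

variable {G : Type w} [Group G] {S : Type u} [Category.{v} S] [MonoidalCategory S] [GCategory G S]
  [IsMonoidalGCategory G S]

theorem act_whiskerLeft (g : G) (X : S) {Y Z : S} (f : Y ⟶ Z) :
    (act g).map (X ◁ f) = eqToHom (IsMonoidalGCategory.act_tensorObj g X Y) ≫
      ((act g).obj X ◁ (act g).map f) ≫
      eqToHom (IsMonoidalGCategory.act_tensorObj g X Z).symm := by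
  refine (conj_eqToHom_iff_heq _ _ (IsMonoidalGCategory.act_tensorObj _ _ _)
    (IsMonoidalGCategory.act_tensorObj _ _ _)).2 ?_
  have h := IsMonoidalGCategory.act_tensorHom g (𝟙 X) f
  rw [CategoryTheory.Functor.map_id, id_tensorHom, id_tensorHom] at h
  exact h

theorem act_associator (g : G) (X Y Z : S) :
    (act g).map (α_ X Y Z).hom = eqToHom (act_tensorObj_left g X Y Z) ≫
      (α_ ((act g).obj X) ((act g).obj Y) ((act g).obj Z)).hom ≫
      eqToHom (act_tensorObj_right g X Y Z).symm := by
  refine (conj_eqToHom_iff_heq _ _ (act_tensorObj_left g X Y Z)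
    (act_tensorObj_right g X Y Z)).2 ?_
  exact IsMonoidalGCategory.act_associator g X Y Z

theorem triple_ext {X Y : GroupCompletion S} {a b : Triple X Y} (hr : a.r = b.r)
    (hf : HEq a.f b.f) (hf' : HEq a.f' b.f') : a = b := by
  cases a; cases b; cases hr; cases hf; cases hf'; rfl

theorem hom_heq {X X' Y Y' : GroupCompletion S} (hX : X = X') (hY : Y = Y') (a : Triple X Y)
    (b : Triple X' Y') (hr : a.r = b.r) (hf : HEq a.f b.f) (hf' : HEq a.f' b.f') :
    HEq (Quotient.mk _ a : X ⟶ Y) (Quotient.mk _ b : X' ⟶ Y') := by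
  subst hX hY
  rw [triple_ext hr hf hf']

/-- `g (m, n) = (gm, gn)`. -/
def actObj (g : G) (X : GroupCompletion S) : GroupCompletion S :=
  ⟨(act g).obj X.fst, (act g).obj X.snd⟩

/-- `g (r, f, f') = (gr, gf, gf')`, using the equality `gr ⊕ gm = g(r ⊕ m)`. -/
def actTriple (g : G) {X Y : GroupCompletion S} (a : Triple X Y) :
    Triple (actObj g X) (actObj g Y) :=
  ⟨(act g).obj a.r,
    eqToHom (IsMonoidalGCategory.act_tensorObj g a.r X.fst).symm ≫ (act g).map a.f,
    eqToHom (IsMonoidalGCategory.act_tensorObj g a.r X.snd).symm ≫ (act g).map a.f'⟩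

theorem act_whiskerRight (g : G) {X Y : S} (f : X ⟶ Y) (Z : S) :
    (act g).map (f ▷ Z) = eqToHom (IsMonoidalGCategory.act_tensorObj g X Z) ≫
      ((act g).map f ▷ (act g).obj Z) ≫
      eqToHom (IsMonoidalGCategory.act_tensorObj g Y Z).symm := by
  refine (conj_eqToHom_iff_heq _ _ (IsMonoidalGCategory.act_tensorObj _ _ _)
    (IsMonoidalGCategory.act_tensorObj _ _ _)).2 ?_
  have h := IsMonoidalGCategory.act_tensorHom g f (𝟙 Z)
  rw [CategoryTheory.Functor.map_id, tensorHom_id, tensorHom_id] at h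
  exact h

/-- The action of `g` on `S⁻¹S`. -/
def actFunctor (g : G) : GroupCompletion S ⥤ GroupCompletion S where
  obj := actObj g
  map := Quotient.map (actTriple g) (by
    rintro a b ⟨e, h, h'⟩
    refine ⟨(act g).mapIso e, ?_, ?_⟩
    · simp [actTriple, actObj, ← h, act_whiskerRight]
    · simp [actTriple, actObj, ← h', act_whiskerRight])
  map_id X := by
    refine congrArg (Quotient.mk _) (triple_ext ?_ ?_ ?_)
    · exact IsMonoidalGCategory.act_tensorUnit g
    · exact (eqToHom_comp_heq _ _).trans (IsMonoidalGCategory.act_leftUnitor g X.fst)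
    · exact (eqToHom_comp_heq _ _).trans (IsMonoidalGCategory.act_leftUnitor g X.snd)
  map_comp := by
    rintro X Y Z ⟨a⟩ ⟨b⟩
    have key : ∀ (r m p s u : S) (f : r ⊗ m ⟶ p) (k : s ⊗ p ⟶ u),
        HEq (eqToHom (IsMonoidalGCategory.act_tensorObj g (s ⊗ r) m).symm ≫
            (act g).map ((α_ s r m).hom ≫ s ◁ f ≫ k))
          ((α_ ((act g).obj s) ((act g).obj r) ((act g).obj m)).hom ≫
            (act g).obj s ◁ (eqToHom (IsMonoidalGCategory.act_tensorObj g r m).symm ≫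
              (act g).map f) ≫
            (eqToHom (IsMonoidalGCategory.act_tensorObj g s p).symm ≫ (act g).map k)) := by
      intro r m p s u f k
      have e : (act g).map ((α_ s r m).hom ≫ s ◁ f ≫ k) =
          eqToHom (act_tensorObj_left g s r m) ≫
          ((α_ ((act g).obj s) ((act g).obj r) ((act g).obj m)).hom ≫
            (act g).obj s ◁ (eqToHom (IsMonoidalGCategory.act_tensorObj g r m).symm ≫
              (act g).map f) ≫
            (eqToHom (IsMonoidalGCategory.act_tensorObj g s p).symm ≫ (act g).map k)) := by
        simp only [CategoryTheory.Functor.map_comp, act_associator, act_whiskerLeft,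
          MonoidalCategory.whiskerLeft_comp, MonoidalCategory.whiskerLeft_eqToHom,
          Category.assoc, eqToHom_trans_assoc]
      rw [e]
      exact (eqToHom_comp_heq _ _).trans (eqToHom_comp_heq _ _)
    refine congrArg (Quotient.mk _) (triple_ext ?_ ?_ ?_)
    · exact IsMonoidalGCategory.act_tensorObj g b.r a.r
    · exact key _ _ _ _ _ a.f b.f
    · exact key _ _ _ _ _ a.f' b.f'

instance : GCategory G (GroupCompletion S) where
  act := actFunctor
  act_one := Functor.hext
    (fun X => mk_eq (act_one_obj X.fst) (act_one_obj X.snd))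
    (by
      rintro X Y ⟨a⟩
      exact hom_heq (mk_eq (act_one_obj X.fst) (act_one_obj X.snd))
        (mk_eq (act_one_obj Y.fst) (act_one_obj Y.snd)) _ _ (act_one_obj a.r)
        ((eqToHom_comp_heq _ _).trans (act_one_map_heq a.f))
        ((eqToHom_comp_heq _ _).trans (act_one_map_heq a.f')))
  act_mul g h := Functor.hext
    (fun X => mk_eq (act_mul_obj g h X.fst) (act_mul_obj g h X.snd))
    (by
      have key : ∀ {A B C : S} (p : A = B) (f : B ⟶ C),
          HEq ((act g).map f) ((act g).map (eqToHom p ≫ f)) := by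
        rintro A _ C rfl f
        simp
      rintro X Y ⟨a⟩
      refine hom_heq (mk_eq (act_mul_obj g h X.fst) (act_mul_obj g h X.snd))
        (mk_eq (act_mul_obj g h Y.fst) (act_mul_obj g h Y.snd)) _ _ (act_mul_obj g h a.r) ?_ ?_
      · exact ((eqToHom_comp_heq _ _).trans (act_mul_map_heq g h a.f)).trans
          ((key _ _).trans (eqToHom_comp_heq _ _).symm)
      · exact ((eqToHom_comp_heq _ _).trans (act_mul_map_heq g h a.f')).trans
          ((key _ _).trans (eqToHom_comp_heq _ _).symm))

end Action

end GroupCompletion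

/-! ## Classifying spaces and equivariant homotopy theory -/

/-- The classifying space `BC`: the geometric realization of the nerve. -/
noncomputable def ClassifyingSpace (C : Type u) [Category.{v} C] : TopCat.{max u v} :=
  SSet.toTop.obj (nerve C)

/-- The continuous map `BF : BC → BD`. -/
noncomputable def classifyingMap {C D : Type u} [Category.{v} C] [Category.{v} D] (F : C ⥤ D) :
    C(ClassifyingSpace C, ClassifyingSpace D) :=
  (SSet.toTop.map (nerveMap F)).hom

theorem classifyingMap_id (C : Type u) [Category.{v} C] (x : ClassifyingSpace C) :
    classifyingMap (𝟭 C) x = x := by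
  have h : nerveMap (𝟭 C) = 𝟙 (nerve C) := rfl
  simp only [classifyingMap, h, CategoryTheory.Functor.map_id]
  rfl

theorem classifyingMap_comp {C D E : Type u} [Category.{v} C] [Category.{v} D] [Category.{v} E]
    (F : C ⥤ D) (K : D ⥤ E) (x : ClassifyingSpace C) :
    classifyingMap (F ⋙ K) x = classifyingMap K (classifyingMap F x) := by
  have h : nerveMap (F ⋙ K) = nerveMap F ≫ nerveMap K := rfl
  simp only [classifyingMap, h, CategoryTheory.Functor.map_comp]
  rfl

/-- The classifying space of a `G`-category is a `G`-space. -/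
noncomputable instance (G : Type w) [Group G] (C : Type u) [Category.{v} C] [GCategory G C] :
    MulAction G (ClassifyingSpace C) where
  smul g x := classifyingMap (act g) x
  one_smul x := by
    change classifyingMap (act (1 : G)) x = x
    rw [act_one, classifyingMap_id]
  mul_smul g h x := by
    change classifyingMap (act (g * h)) x = classifyingMap (act g) (classifyingMap (act h) x)
    rw [act_mul, classifyingMap_comp]

/-- The map on path components induced by a continuous map. -/
def piZeroMap {X : Type u₁} {Y : Type u₂} [TopologicalSpace X] [TopologicalSpace Y] (f : C(X, Y)) :
    ZerothHomotopy X → ZerothHomotopy Y :=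
  ZerothHomotopy.lift (fun x => ZerothHomotopy.mk (f x))
    (fun _ _ p => ZerothHomotopy.sound (p.map f.continuous))

/-- The map `π_n(X, x) → π_n(Y, f x)` induced by a continuous map. -/
def piMap {X : Type u₁} {Y : Type u₂} [TopologicalSpace X] [TopologicalSpace Y] (f : C(X, Y))
    (n : ℕ) (x : X) : HomotopyGroup (Fin n) X x → HomotopyGroup (Fin n) Y (f x) :=
  Quotient.map (fun p => ⟨f.comp p.1, fun y hy => congrArg f (p.2 y hy)⟩)
    (fun _ _ h => h.map fun H => H.compContinuousMap f)

/-- Weak homotopy equivalences: bijections on path components and on `π_n` for all `n ≥ 1` and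
all base points. -/
def IsWeakHomotopyEquivalence {X : Type u₁} {Y : Type u₂} [TopologicalSpace X]
    [TopologicalSpace Y] (f : C(X, Y)) : Prop :=
  Function.Bijective (piZeroMap f) ∧
    ∀ (n : ℕ) (x : X), 1 ≤ n → Function.Bijective (piMap f n x)

/-- The map `X^H → Y^H` on fixed point spaces induced by a `G`-map. -/
def fixedPointsMap {G : Type w} [Group G] {X : Type u₁} {Y : Type u₂} [TopologicalSpace X]
    [TopologicalSpace Y] [MulAction G X] [MulAction G Y] (f : C(X, Y))
    (hf : ∀ (g : G) (x : X), f (g • x) = g • f x) (H : Subgroup G) :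
    C(MulAction.fixedPoints H X, MulAction.fixedPoints H Y) where
  toFun x := ⟨f x.1, fun h => (hf h.1 x.1).symm.trans (congrArg f (x.2 h))⟩
  continuous_toFun := by fun_prop

/-- A weak `G`-equivalence of `G`-spaces: a `G`-map inducing weak homotopy equivalences on the
fixed points of all subgroups. -/
def IsWeakGEquivalence (G : Type w) [Group G] {X : Type u₁} {Y : Type u₂} [TopologicalSpace X]
    [TopologicalSpace Y] [MulAction G X] [MulAction G Y] (f : C(X, Y)) : Prop :=
  ∃ hf : ∀ (g : G) (x : X), f (g • x) = g • f x,
    ∀ H : Subgroup G, IsWeakHomotopyEquivalence (fixedPointsMap f hf H)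

/-- A `G`-homotopy equivalence between `G`-spaces, with both homotopies through `G`-maps. -/
structure GHomotopyEquiv (G : Type w) [Group G] (X : Type u₁) (Y : Type u₂) [TopologicalSpace X]
    [TopologicalSpace Y] [MulAction G X] [MulAction G Y] where
  toFun : C(X, Y)
  invFun : C(Y, X)
  toFun_smul : ∀ (g : G) (x : X), toFun (g • x) = g • toFun x
  invFun_smul : ∀ (g : G) (y : Y), invFun (g • y) = g • invFun y
  left : (invFun.comp toFun).Homotopy (ContinuousMap.id X)
  right : (toFun.comp invFun).Homotopy (ContinuousMap.id Y)
  left_smul : ∀ (g : G) (t : I) (x : X), left (t, g • x) = g • left (t, x)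
  right_smul : ∀ (g : G) (t : I) (y : Y), right (t, g • y) = g • right (t, y)

/-! ## Equivariant Morita equivalence and equivariant algebraic `K`-theory -/

/-- `R` and `S` are equivariantly Morita equivalent: there is an equivalence `Mod(R) → Mod(S)` of
the categories of all modules which is pseudo equivariant. -/
def EquivariantlyMoritaEquivalent (G : Type w) [Group G] (R S : Type u) [Ring R] [Ring S]
    [MulSemiringAction G R] [MulSemiringAction G S] : Prop :=
  ∃ Θ : PseudoEquivariantFunctor G (ModuleCat.{u} R) (ModuleCat.{u} S), Θ.functor.IsEquivalence

/-- The variant in which `Mod` denotes the category of finitely generated modules. -/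
def FGEquivariantlyMoritaEquivalent (G : Type w) [Group G] (R S : Type u) [Ring R] [Ring S]
    [MulSemiringAction G R] [MulSemiringAction G S] : Prop :=
  ∃ Θ : PseudoEquivariantFunctor G (FGModuleCat.{u} R) (FGModuleCat.{u} S),
    Θ.functor.IsEquivalence

/-- The equivariant algebraic `K`-theory space `K_G(R) = B(S⁻¹S)`, where
`S = Cat(G̃, iso P(R))` with the pointwise direct sum. The symmetry of `⊕` does not enter the
construction of the `G`-category `S⁻¹S`. -/
noncomputable abbrev KSpace (G : Type w) [Group G] (R : Type u) [Ring R] [MulSemiringAction G R] :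
    TopCat :=
  ClassifyingSpace (GroupCompletion (CatTilde G (Core (ProjModuleCat.{u} R))))

end EquivariantK

/-! A pseudo equivariant equivalence `Θ` commutes with the group only up to the isomorphisms `θ`,
but `Cat(G̃, -)` rectifies it. The functor sending `X` to `x ↦ x Θ(x⁻¹ X(x))` is isomorphic to
composition with `Θ`, hence fully faithful. It commutes strictly with conjugation because `x⁻¹ g =
(g⁻¹ x)⁻¹`, and on morphisms this is precisely the cocycle condition on `θ`. The same device makes a
quasi-inverse strict: at `x`, choose a `Θ`-preimage of `x⁻¹ Y(x)` and translate it back by `x`.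
Conjugating `Y` by `g` does not change the object at which the choice is made. So
`catTildeEquivalence` is an equivalence in which functors and natural isomorphisms are strictly
equivariant. Such an equivalence restricts to all fixed point categories
(`isEquivalence_fixedFunctor`) and realizes to a `G`-homotopy equivalence (`gHomotopyEquiv`), which
is a weak `G`-equivalence.

Two topological facts are proved by hand. First, a natural isomorphism gives a homotopy of
classifying spaces, naturally enough to be equivariant (`natIsoHomotopy_naturality`). It is enough
to have a natural map `BC → Map(I, B(C × {0 ≅ 1}))`. With the path space as target, the realization
adjunction defines it simplex by simplex: barycentric coordinates are laid out as consecutive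
intervals in `[0, 1]`, and the part below `c` is put at one end of the cylinder, the rest at the
other. Second, a homotopy equivalence is bijective on homotopy groups at every base point
(`isWeakHomotopyEquivalence_of_homotopy`), although the homotopies move base points. This uses
transport of maps of cubes along a path.

For modules, finite generation and projectivity are categorical, so `Θ` restricts to finitely
generated projectives. There `⊕` is the categorical product, so `Θ` is automatically monoidal and
each `θ_g` automatically respects `⊕` (`preservesTensor_of_cartesian`). This compatibility passes to
isomorphism groupoids and to `Cat(G̃, -)`, where it makes the tensorator strictly equivariant. The
equivalence therefore carries over to `S⁻¹S` (`mapGEquivalence`), and realization finishes the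
proof. -/

namespace EquivariantK

open GCategory

/-! ## Homotopy equivalences are weak homotopy equivalences -/

section HomotopyGroups

variable {n : ℕ} {X : Type u₁} [TopologicalSpace X] {Y : Type u₂} [TopologicalSpace Y]

/-- Scaling of the cube by `r` about its centre, followed by the retraction to the cube. -/
noncomputable def cubeScale (r : ℝ) (y : Fin n → I) : Fin n → I :=
  fun i => Set.projIcc (0 : ℝ) 1 zero_le_one (1 / 2 + r * ((y i : ℝ) - 1 / 2))

/-- The distance from the centre of the cube, which is `1` on the boundary. -/
noncomputable def cubeRadius (y : Fin n → I) : ℝ := ‖fun i => 2 * (y i : ℝ) - 1‖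

theorem continuous_cubeScale {Z : Type*} [TopologicalSpace Z] {r : Z → ℝ} {y : Z → Fin n → I}
    (hr : Continuous r) (hy : Continuous y) : Continuous fun z => cubeScale (r z) (y z) := by
  refine continuous_pi fun i => continuous_projIcc.comp ?_
  have : Continuous fun z => ((y z i : I) : ℝ) :=
    continuous_subtype_val.comp ((continuous_apply i).comp hy)
  fun_prop

@[fun_prop]
theorem continuous_cubeRadius : Continuous (cubeRadius (n := n)) := by
  unfold cubeRadius; fun_prop

theorem cubeScale_one (y : Fin n → I) : cubeScale 1 y = y := by
  funext i
  have h : (1 / 2 + 1 * ((y i : ℝ) - 1 / 2)) = y i := by ring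
  simp only [cubeScale, h]
  exact Set.projIcc_val zero_le_one (y i)

theorem cubeRadius_le_one (y : Fin n → I) : cubeRadius y ≤ 1 := by
  refine (pi_norm_le_iff_of_nonneg zero_le_one).2 fun i => ?_
  have h0 := (y i).2.1
  have h1 := (y i).2.2
  rw [Real.norm_eq_abs, abs_le]
  constructor <;> linarith

theorem cubeRadius_boundary {y : Fin n → I} (hy : y ∈ Cube.boundary (Fin n)) :
    cubeRadius y = 1 := by
  refine le_antisymm (cubeRadius_le_one y) ?_
  obtain ⟨i, hi⟩ := hy
  refine le_trans ?_ (norm_le_pi_norm (fun i => 2 * (y i : ℝ) - 1) i)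
  rcases hi with hi | hi <;> simp [hi]
  norm_num

/-- If no coordinate is clamped to `0` or `1`, then every coordinate of `r (2y - 1)` has absolute
value below `1`, and so does the sup norm `r * cubeRadius y`. -/
theorem cubeScale_boundary {r : ℝ} (hr : 0 ≤ r) {y : Fin n → I} (h : 1 ≤ r * cubeRadius y) :
    cubeScale r y ∈ Cube.boundary (Fin n) := by
  by_contra hc
  have key : ‖r • fun i => 2 * (y i : ℝ) - 1‖ < 1 := by
    refine (pi_norm_lt_iff zero_lt_one).2 fun i => ?_
    have hi : ¬ (cubeScale r y i = 0 ∨ cubeScale r y i = 1) := fun h => hc ⟨i, h⟩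
    rw [not_or] at hi
    have h0 : 0 < 1 / 2 + r * ((y i : ℝ) - 1 / 2) := by
      by_contra h'
      exact hi.1 (Set.projIcc_of_le_left _ (not_lt.1 h'))
    have h1 : 1 / 2 + r * ((y i : ℝ) - 1 / 2) < 1 := by
      by_contra h'
      exact hi.2 (Set.projIcc_of_right_le _ (not_lt.1 h'))
    rw [Pi.smul_apply, smul_eq_mul, Real.norm_eq_abs, abs_lt]
    constructor <;> linarith
  rw [norm_smul, Real.norm_of_nonneg hr] at key
  exact absurd h (not_le.2 key)

/-- `p` and `q` are homotopic through maps that are constant on the boundary of the cube, with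
value `γ t` at time `t`. -/
def HomotopicAlong (γ : C(I, X)) (p q : C(Fin n → I, X)) : Prop :=
  ∃ K : C(I × (Fin n → I), X), (∀ y, K (0, y) = p y) ∧ (∀ y, K (1, y) = q y) ∧
    ∀ t, ∀ y ∈ Cube.boundary (Fin n), K (t, y) = γ t

theorem HomotopicAlong.symm {γ : C(I, X)} {p q : C(Fin n → I, X)} (h : HomotopicAlong γ p q) :
    HomotopicAlong (γ.comp ⟨σ, unitInterval.continuous_symm⟩) q p := by
  obtain ⟨K, h0, h1, hb⟩ := h
  refine ⟨K.comp ⟨fun z => (σ z.1, z.2), by fun_prop⟩, fun y => ?_, fun y => ?_, fun t y hy => ?_⟩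
  · simpa using h1 y
  · simpa using h0 y
  · exact hb (σ t) y hy

/-- The map equal to `p` on the inner half of the cube, and to `γ` radially on the outer half. -/
noncomputable def shell (γ : C(I, X)) (p : (Fin n → I) → X) (y : Fin n → I) : X :=
  if 2 * cubeRadius y ≤ 1 then p (cubeScale 2 y)
  else γ (Set.projIcc (0 : ℝ) 1 zero_le_one (2 * cubeRadius y - 1))

/-- At radius `1/2` doubling reaches the boundary of the cube, where `L` equals `γ 0`, so the two
branches agree. The parameter `Z` allows a whole homotopy to be extended at once. -/
theorem continuous_shell {Z : Type*} [TopologicalSpace Z] (γ : C(I, X)) {L : Z × (Fin n → I) → X}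
    (hL : Continuous L) (hb : ∀ z, ∀ y ∈ Cube.boundary (Fin n), L (z, y) = γ 0) :
    Continuous fun a : Z × (Fin n → I) => shell γ (fun y => L (a.1, y)) a.2 := by
  unfold shell
  refine Continuous.if_le ?_ ?_ (by fun_prop) continuous_const ?_
  · exact hL.comp (continuous_fst.prodMk (continuous_cubeScale continuous_const continuous_snd))
  · exact γ.continuous.comp (continuous_projIcc.comp (by fun_prop))
  · intro a ha
    dsimp only
    rw [hb _ _ (cubeScale_boundary zero_le_two ha.ge), Set.projIcc_of_le_left _ (by linarith)]
    rfl

theorem shell_boundary (γ : C(I, X)) (p : (Fin n → I) → X) {y : Fin n → I}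
    (hy : y ∈ Cube.boundary (Fin n)) : shell γ p y = γ 1 := by
  rw [shell, cubeRadius_boundary hy, if_neg (by norm_num), Set.projIcc_of_right_le _ (by norm_num)]
  rfl

/-- A normal form for transport: up to homotopy relative to the boundary, the end `q` depends only
on `p` and `γ`, not on the homotopy joining them. -/
theorem HomotopicAlong.exists_rel_shell {γ : C(I, X)} {p q : C(Fin n → I, X)}
    (h : HomotopicAlong γ p q) (s : C(Fin n → I, X)) (hs : ∀ y, s y = shell γ p y) :
    q.HomotopicRel s (Cube.boundary (Fin n)) := by
  obtain ⟨K, h0, h1, hb⟩ := h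
  -- At time `s` the cube is stretched by `1 + s`, and `K` is evaluated at time `max (1 - s) (2|y| -
  -- 1)`. This is `q` for `s = 0`. For `s = 1` it is `p` stretched by `2` on the inner half; further
  -- out the stretched point is clamped to the boundary, where `K` follows `γ`.
  refine ⟨⟨⟨⟨fun z => K (Set.projIcc (0 : ℝ) 1 zero_le_one (max (1 - z.1) (2 * cubeRadius z.2 - 1)),
    cubeScale (1 + z.1) z.2), ?_⟩, fun y => ?_, fun y => ?_⟩, fun t y hy => ?_⟩⟩
  · refine K.continuous.comp (Continuous.prodMk (continuous_projIcc.comp (by fun_prop)) ?_)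
    exact continuous_cubeScale (by fun_prop) continuous_snd
  · have : Set.projIcc (0 : ℝ) 1 zero_le_one (max (1 - (0 : I)) (2 * cubeRadius y - 1)) = 1 :=
      Set.projIcc_of_right_le _ (by simp)
    simp only [this]
    rw [h1]
    simp [cubeScale_one]
  · have e : (1 + ((1 : I) : ℝ)) = 2 := by norm_num
    simp only [e, hs, shell]
    split_ifs with hy
    · rw [← h0]
      congr 2
      exact Set.projIcc_of_le_left _ (by simp; linarith)
    · rw [hb _ _ (cubeScale_boundary zero_le_two (not_le.1 hy).le)]
      congr 2
      simp only [Set.Icc.coe_one, sub_self]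
      exact max_eq_right (by linarith [not_le.1 hy])
  · have hr := cubeRadius_boundary hy
    change K _ = q y
    have : Set.projIcc (0 : ℝ) 1 zero_le_one (max (1 - (t : ℝ)) (2 * cubeRadius y - 1)) = 1 :=
      Set.projIcc_of_right_le _ (by rw [hr]; norm_num)
    rw [← h1, hb 1 y hy]
    simp only [this]
    refine hb 1 _ (cubeScale_boundary (by linarith [t.2.1]) ?_)
    rw [hr]; linarith [t.2.1]

/-- Transport along `γ` is well defined on classes relative to the boundary: both ends are compared
with shells, and the shell of a homotopy from `p` to `p'` joins these. -/
theorem HomotopicAlong.homotopicRel {γ : C(I, X)} {p q p' q' : C(Fin n → I, X)}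
    (h : HomotopicAlong γ p q) (h' : HomotopicAlong γ p' q')
    (hp : p.HomotopicRel p' (Cube.boundary (Fin n))) :
    q.HomotopicRel q' (Cube.boundary (Fin n)) := by
  have hpb : ∀ y ∈ Cube.boundary (Fin n), p y = γ 0 := by
    obtain ⟨K, h0, -, hb⟩ := h
    intro y hy
    rw [← h0, hb 0 y hy]
  obtain ⟨L⟩ := hp
  have hL : ∀ (t : I), ∀ y ∈ Cube.boundary (Fin n), L (t, y) = γ 0 := fun t y hy => by
    rw [L.eq_fst t hy, hpb y hy]
  let M : C(I × (Fin n → I), X) := ⟨_, continuous_shell γ L.continuous hL⟩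
  have hM : ∀ t y, M (t, y) = shell γ (fun y => L (t, y)) y := fun _ _ => rfl
  clear_value M
  let s : I → C(Fin n → I, X) := fun t => M.comp ⟨fun y => (t, y), by fun_prop⟩
  have hs : ∀ t y, s t y = M (t, y) := fun _ _ => rfl
  have e0 : (fun y => L (0, y)) = p := funext fun y => L.apply_zero y
  have e1 : (fun y => L (1, y)) = p' := funext fun y => L.apply_one y
  have h1 := h.exists_rel_shell (s 0) fun y => by rw [hs, hM, e0]
  have h2 := h'.exists_rel_shell (s 1) fun y => by rw [hs, hM, e1]
  have h3 : (s 0).HomotopicRel (s 1) (Cube.boundary (Fin n)) :=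
    ⟨⟨⟨M, fun y => rfl, fun y => rfl⟩, fun t y hy => by
      change M (t, y) = M (0, y)
      rw [hM, hM, shell_boundary _ _ hy, shell_boundary _ _ hy]⟩⟩
  exact (h1.trans h3).trans h2.symm

/-- Homotopy extension for the pair of cube and boundary, written out: at time `t` the map `p` is
squeezed into radius `1 / (1 + t)` and the collar is filled by `γ`, which arrives at `γ t` on the
boundary. -/
theorem exists_homotopicAlong (γ : C(I, X)) (p : C(Fin n → I, X))
    (hp : ∀ y ∈ Cube.boundary (Fin n), p y = γ 0) : ∃ q, HomotopicAlong γ p q := by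
  let K : I × (Fin n → I) → X := fun z =>
    if (1 + (z.1 : ℝ)) * cubeRadius z.2 ≤ 1 then p (cubeScale (1 + z.1) z.2)
    else γ (Set.projIcc (0 : ℝ) 1 zero_le_one ((1 + z.1) * cubeRadius z.2 - 1))
  have hK : Continuous K := by
    refine Continuous.if_le ?_ ?_ (by fun_prop) continuous_const ?_
    · exact p.continuous.comp (continuous_cubeScale (by fun_prop) continuous_snd)
    · exact γ.continuous.comp (continuous_projIcc.comp (by fun_prop))
    · intro a ha
      rw [hp _ (cubeScale_boundary (by linarith [a.1.2.1]) ha.ge),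
        Set.projIcc_of_le_left _ (by linarith)]
      rfl
  refine ⟨⟨fun y => K (1, y), hK.comp (continuous_const.prodMk continuous_id)⟩, ⟨K, hK⟩,
    fun y => ?_, fun y => rfl, fun t y hy => ?_⟩
  · have : (1 + ((0 : I) : ℝ)) * cubeRadius y ≤ 1 := by simpa using cubeRadius_le_one y
    simp only [ContinuousMap.coe_mk, K, if_pos this]
    simp [cubeScale_one]
  · simp only [ContinuousMap.coe_mk, K, cubeRadius_boundary hy, mul_one]
    split_ifs with ht
    · have h0 : t = 0 := Subtype.ext (le_antisymm (by simpa using ht) t.2.1)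
      rw [hp _ (cubeScale_boundary (by linarith [t.2.1]) _), h0]
      rw [cubeRadius_boundary hy]; linarith [t.2.1]
    · congr 1
      rw [add_sub_cancel_left]
      exact Set.projIcc_val zero_le_one t

theorem homotopicAlong_comp {φ : C(X, X)} (H : φ.Homotopy (ContinuousMap.id X)) {x : X}
    (p : C(Fin n → I, X)) (hp : ∀ y ∈ Cube.boundary (Fin n), p y = x) :
    HomotopicAlong (H.toContinuousMap.comp ⟨fun t => (t, x), by fun_prop⟩) (φ.comp p) p := by
  refine ⟨H.toContinuousMap.comp ⟨fun z => (z.1, p z.2), by fun_prop⟩, fun y => ?_, fun y => ?_,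
    fun t y hy => ?_⟩
  · exact H.apply_zero (p y)
  · exact H.apply_one (p y)
  · exact congrArg (fun a => H (t, a)) (hp y hy)

/-- Transport along the track of the base point under `H` undoes composition with `φ`, so that
composition is injective on classes. -/
theorem homotopicRel_of_comp {φ : C(X, X)} (H : φ.Homotopy (ContinuousMap.id X)) {x : X}
    (p q : C(Fin n → I, X)) (hp : ∀ y ∈ Cube.boundary (Fin n), p y = x)
    (hq : ∀ y ∈ Cube.boundary (Fin n), q y = x)
    (h : (φ.comp p).HomotopicRel (φ.comp q) (Cube.boundary (Fin n))) :
    p.HomotopicRel q (Cube.boundary (Fin n)) :=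
  (homotopicAlong_comp H p hp).homotopicRel (homotopicAlong_comp H q hq) h

theorem homotopicRel_comp_left (f : C(X, Y)) {p q : C(Fin n → I, X)}
    (h : p.HomotopicRel q (Cube.boundary (Fin n))) :
    (f.comp p).HomotopicRel (f.comp q) (Cube.boundary (Fin n)) :=
  h.map fun H => H.compContinuousMap f

theorem isWeakHomotopyEquivalence_of_homotopy (f : C(X, Y)) (g : C(Y, X))
    (H : (g.comp f).Homotopy (ContinuousMap.id X))
    (H' : (f.comp g).Homotopy (ContinuousMap.id Y)) : IsWeakHomotopyEquivalence f := by
  refine ⟨Function.bijective_iff_has_inverse.2 ⟨piZeroMap g, ?_, ?_⟩, fun n x _ => ⟨?_, ?_⟩⟩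
  · rintro ⟨x⟩
    exact ZerothHomotopy.sound (H.evalAt x)
  · rintro ⟨y⟩
    exact ZerothHomotopy.sound (H'.evalAt y)
  · rintro ⟨p⟩ ⟨q⟩ h
    have h' : (f.comp p.1).HomotopicRel (f.comp q.1) (Cube.boundary (Fin n)) := Quotient.exact h
    exact Quotient.sound (homotopicRel_of_comp H p.1 q.1 p.2 q.2 (homotopicRel_comp_left g h'))
  · rintro ⟨q⟩
    -- The map `g ∘ q` is based at `g (f x)`; transport along this path, from `g (f x)` to `x`,
    -- gives a candidate preimage based at `x`.
    let γ : C(I, X) := H.toContinuousMap.comp ⟨fun t => (t, x), by fun_prop⟩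
    have hγ : γ 1 = x := H.apply_one x
    obtain ⟨p, hp⟩ := exists_homotopicAlong γ (g.comp q.1) fun y hy =>
      (congrArg g (q.2 y hy)).trans (H.apply_zero x).symm
    have hpx : ∀ y ∈ Cube.boundary (Fin n), p y = x := by
      obtain ⟨K, -, h1, hb⟩ := hp
      intro y hy
      rw [← h1, hb 1 y hy, hγ]
    refine ⟨Quotient.mk _ ⟨p, hpx⟩, Quotient.sound ?_⟩
    change (f.comp p).HomotopicRel q.1 _
    -- Both `g ∘ f ∘ p` and `g ∘ q` arise from `p` by transport along the reversed path, so they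
    -- agree up to homotopy; applying `f` and cancelling `f ∘ g` gives the claim.
    have h := (homotopicAlong_comp H p hpx).symm.homotopicRel hp.symm
      (ContinuousMap.HomotopicRel.refl p)
    exact homotopicRel_of_comp H' (x := f x) _ _ (fun y hy => congrArg f (hpx y hy)) q.2
      (homotopicRel_comp_left f h)

end HomotopyGroups

/-! ## Cutting a simplex into two parts -/

section Cut

variable {n m : ℕ}

/-- Lay out intervals of lengths `t 0, t 1, …` consecutively from the origin: `cut t c i` is the
length of the part of the `i`-th interval below `c`. -/
noncomputable def cut (t : Fin (n + 1) → ℝ) (c : ℝ) (i : Fin (n + 1)) : ℝ :=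
  min (∑ j ∈ Finset.Iic i, t j) c - min (∑ j ∈ Finset.Iio i, t j) c

theorem sum_Iic_eq (t : Fin (n + 1) → ℝ) (i : Fin (n + 1)) :
    ∑ j ∈ Finset.Iic i, t j = ∑ j ∈ Finset.Iio i, t j + t i := by
  rw [← Finset.Iio_insert, Finset.sum_insert (by simp), add_comm]

/-- Telescoping. A nonempty lower set is `Iic a` for its largest element `a`, and removing `a`
leaves the lower set `Iio a`. -/
theorem sum_cut (t : Fin (n + 1) → ℝ) {c : ℝ} (hc : 0 ≤ c) (A : Finset (Fin (n + 1)))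
    (hA : IsLowerSet (A : Set (Fin (n + 1)))) :
    ∑ i ∈ A, cut t c i = min (∑ i ∈ A, t i) c := by
  induction A using Finset.strongInduction with
  | H A ih =>
    rcases A.eq_empty_or_nonempty with rfl | hne
    · simp [hc]
    · obtain ⟨a, ha, hmax⟩ := A.exists_max_image id hne
      have e : A = Finset.Iic a := by
        ext j
        rw [Finset.mem_Iic]
        exact ⟨fun h => hmax j h, fun h => hA h ha⟩
      subst e
      rw [← Finset.Iio_insert, Finset.sum_insert (by simp), ih (Finset.Iio a)
        (Finset.ssubset_iff_subset_ne.2 ⟨fun j hj => by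
          rw [Finset.mem_Iio] at hj; exact Finset.mem_Iic.2 hj.le, fun h => by
          have := Finset.mem_Iic.2 (le_refl a)
          rw [← h] at this
          simp at this⟩) (by rw [Finset.coe_Iio]; exact isLowerSet_Iio a), Finset.Iio_insert]
      simp [cut]

theorem cut_nonneg (t : stdSimplex ℝ (Fin (n + 1))) (c : ℝ) (i : Fin (n + 1)) :
    0 ≤ cut t c i := by
  rw [cut, sub_nonneg, sum_Iic_eq]
  exact min_le_min_right _ (by linarith [stdSimplex.zero_le t i])

theorem cut_le (t : stdSimplex ℝ (Fin (n + 1))) (c : ℝ) (i : Fin (n + 1)) :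
    cut t c i ≤ t i := by
  rw [cut, sub_le_iff_le_add, sum_Iic_eq, add_comm (t i)]
  have h := stdSimplex.zero_le t i
  rcases le_total (∑ j ∈ Finset.Iio i, t j) c with h1 | h1
  · rw [min_eq_left h1]; exact min_le_left _ _
  · rw [min_eq_right h1]; exact (min_le_right _ _).trans (by linarith)

theorem continuous_cut (i : Fin (n + 1)) :
    Continuous fun z : stdSimplex ℝ (Fin (n + 1)) × I => cut z.1 z.2 i := by
  have h : ∀ j, Continuous fun z : stdSimplex ℝ (Fin (n + 1)) × I => z.1 j := fun j =>
    (continuous_apply j).comp (continuous_subtype_val.comp continuous_fst)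
  unfold cut
  fun_prop

/-- The point of the simplex on `Fin (n + 1) × Bool` whose weight at `(i, true)` is the part of
the `i`-th interval below `c`, and whose weight at `(i, false)` is the rest of that interval. -/
noncomputable def split (t : stdSimplex ℝ (Fin (n + 1))) (c : I) :
    stdSimplex ℝ (Fin (n + 1) × Bool) :=
  ⟨fun x => bif x.2 then cut t c x.1 else t x.1 - cut t c x.1, by
    refine ⟨?_, ?_⟩
    · rintro ⟨i, b | b⟩
      · exact sub_nonneg.2 (cut_le t c i)
      · exact cut_nonneg t c i
    · rw [Fintype.sum_prod_type]
      simp⟩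

theorem split_true (t : stdSimplex ℝ (Fin (n + 1))) (c : I) (i : Fin (n + 1)) :
    split t c (i, true) = cut t c i := rfl

theorem split_false (t : stdSimplex ℝ (Fin (n + 1))) (c : I) (i : Fin (n + 1)) :
    split t c (i, false) = t i - cut t c i := rfl

theorem continuous_split :
    Continuous fun z : stdSimplex ℝ (Fin (n + 1)) × I => split z.1 z.2 := by
  refine Continuous.subtype_mk (continuous_pi ?_) _
  rintro ⟨i, b | b⟩
  · exact ((continuous_apply i).comp (continuous_subtype_val.comp continuous_fst)).sub
      (continuous_cut i)
  · exact continuous_cut i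

theorem map_apply {A B : Type*} [Fintype A] [Fintype B] [DecidableEq B] (f : A → B)
    (x : stdSimplex ℝ A) (b : B) : stdSimplex.map f x b = ∑ a with f a = b, x a :=
  FunOnFinite.linearMap_apply_apply ℝ ℝ f x b

theorem map_eq_self {A : Type*} [Fintype A] (f : A → A) (x : stdSimplex ℝ A)
    (h : ∀ a, x a ≠ 0 → f a = a) : stdSimplex.map f x = x := by
  classical
  ext b
  rw [map_apply, Finset.sum_filter]
  refine (Finset.sum_eq_single b (fun a _ hab => ?_) (by simp)).trans ?_
  · split_ifs with hfa
    · by_contra h0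
      exact hab ((h a h0).symm.trans hfa)
    · rfl
  · by_cases h0 : x b = 0
    · simp [h0]
    · simp [h b h0]

/-- The preimage of an initial segment under a monotone map is an initial segment, so `sum_cut`
computes the partial sums on both sides. This is what makes the homotopy compatible with faces and
degeneracies. -/
theorem cut_map (θ : Fin (m + 1) →o Fin (n + 1)) (t : stdSimplex ℝ (Fin (m + 1))) (c : I)
    (j : Fin (n + 1)) : cut (stdSimplex.map θ t) c j = ∑ i with θ i = j, cut t c i := by
  have hs : ∀ (f : Fin (m + 1) → ℝ) (B : Finset (Fin (n + 1))),
      ∑ i ∈ B, ∑ a with θ a = i, f a = ∑ a with θ a ∈ B, f a := fun f B =>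
    Finset.sum_fiberwise_eq_sum_filter _ _ _ _
  have hl : ∀ B : Finset (Fin (n + 1)), IsLowerSet (B : Set (Fin (n + 1))) →
      min (∑ i ∈ B, stdSimplex.map θ t i) c = ∑ i ∈ B, ∑ a with θ a = i, cut t c a := by
    intro B hB
    simp only [map_apply]
    rw [hs, hs, sum_cut _ c.2.1]
    intro a a' ha h
    rw [Finset.mem_coe, Finset.mem_filter] at h ⊢
    exact ⟨Finset.mem_univ _, hB (θ.monotone ha) h.2⟩
  rw [cut, hl _ (by rw [Finset.coe_Iic]; exact isLowerSet_Iic j),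
    hl _ (by rw [Finset.coe_Iio]; exact isLowerSet_Iio j), sum_Iic_eq, add_sub_cancel_left]

theorem split_map (θ : Fin (m + 1) →o Fin (n + 1)) (t : stdSimplex ℝ (Fin (m + 1))) (c : I) :
    split (stdSimplex.map θ t) c = stdSimplex.map (Prod.map θ id) (split t c) := by
  have h : ∀ (f : Fin (m + 1) × Bool → ℝ) (j : Fin (n + 1)) (b : Bool),
      ∑ x with Prod.map θ id x = (j, b), f x = ∑ a with θ a = j, f (a, b) := by
    intro f j b
    simp only [Finset.sum_filter, Fintype.sum_prod_type, Prod.map_apply, id_eq, Prod.mk.injEq]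
    refine Finset.sum_congr rfl fun a _ => ?_
    cases b <;> simp
  ext ⟨j, b⟩
  rw [map_apply, h]
  cases b
  · simp only [split_false, cut_map, map_apply, Finset.sum_sub_distrib]
  · simp only [split_true, cut_map]

/-- Only one interval can be cut properly: take `k` to be the first whose right end is at least `c`.
-/
theorem exists_cut_index (t : stdSimplex ℝ (Fin (n + 1))) (c : I) :
    ∃ k, (∀ i < k, cut t c i = t i) ∧ ∀ i, k < i → cut t c i = 0 := by
  have hex : ∃ k, (c : ℝ) ≤ ∑ j ∈ Finset.Iic k, t j := by
    refine ⟨Fin.last n, c.2.2.trans ?_⟩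
    have : Finset.Iic (Fin.last n) = Finset.univ := by ext j; simp [Fin.le_last]
    rw [this, stdSimplex.sum_eq_one]
  obtain ⟨k, hk, hmin⟩ := WellFounded.has_min (wellFounded_lt (α := Fin (n + 1)))
    {k | (c : ℝ) ≤ ∑ j ∈ Finset.Iic k, t j} hex
  refine ⟨k, fun i hi => ?_, fun i hi => ?_⟩
  · have h1 : ∑ j ∈ Finset.Iic i, t j < c := not_le.1 fun h => hmin i h hi
    have h2 := sum_Iic_eq t i
    have h3 := stdSimplex.zero_le t i
    rw [cut, min_eq_left h1.le, min_eq_left (by linarith)]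
    linarith
  · have h1 : ∑ j ∈ Finset.Iic k, t j ≤ ∑ j ∈ Finset.Iio i, t j :=
      Finset.sum_le_sum_of_subset_of_nonneg
        (fun j hj => Finset.mem_Iio.2 ((Finset.mem_Iic.1 hj).trans_lt hi))
        fun j _ _ => stdSimplex.zero_le t j
    have h2 := sum_Iic_eq t i
    have h3 := stdSimplex.zero_le t i
    have hk' : (c : ℝ) ≤ ∑ j ∈ Finset.Iic k, t j := hk
    rw [cut, min_eq_right (by linarith), min_eq_right (by linarith), sub_self]

/-- The chain `(0, true), …, (k, true), (k, false), …, (m, false)`. -/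
def shuffle (k : Fin (m + 1)) (j : Fin (m + 2)) : Fin (m + 1) × Bool :=
  if h : j.1 ≤ k.1 then (⟨j.1, h.trans_lt k.2⟩, true) else (⟨j.1 - 1, by omega⟩, false)

/-- A left inverse on vertices to all `shuffle k`. -/
def flatten (x : Fin (m + 1) × Bool) : Fin (m + 2) :=
  bif x.2 then x.1.castSucc else x.1.succ

/-- The prism over a simplex is covered by its shuffle simplices: with `k` the interval containing
the cut, all weight of `split t c` lies on the chain `shuffle k`, and there `shuffle k ∘ flatten` is
the identity. -/
theorem exists_shuffle (t : stdSimplex ℝ (Fin (m + 1))) (c : I) :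
    ∃ k, stdSimplex.map (shuffle k) (stdSimplex.map flatten (split t c)) = split t c := by
  obtain ⟨k, h1, h2⟩ := exists_cut_index t c
  refine ⟨k, ?_⟩
  rw [stdSimplex.map_comp_apply]
  refine map_eq_self _ _ ?_
  rintro ⟨i, b⟩ hi
  cases b
  · have hk : k ≤ i := not_lt.1 fun hik => hi (by rw [split_false, h1 i hik, sub_self])
    have : ¬ i.1 + 1 ≤ k.1 := by have := Fin.le_def.1 hk; omega
    simp [shuffle, flatten, this]
  · have hk : i ≤ k := not_lt.1 fun hik => hi (by rw [split_true, h2 i hik])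
    have : i.1 ≤ k.1 := hk
    simp [shuffle, flatten, this]

/-- The lexicographic enumeration of `Fin (n + 1) × Bool`. -/
def interleave (x : Fin (n + 1) × Bool) : Fin (2 * n + 1 + 1) :=
  ⟨2 * x.1.1 + (bif x.2 then 0 else 1), by
    have := x.1.2
    cases x.2 <;> simp <;> omega⟩

/-- The inverse of `interleave`. -/
def uninterleave (i : Fin (2 * n + 1 + 1)) : Fin (n + 1) × Bool :=
  (⟨i.1 / 2, by omega⟩, decide (i.1 % 2 = 0))

theorem uninterleave_interleave (x : Fin (n + 1) × Bool) : uninterleave (interleave x) = x := by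
  obtain ⟨i, b⟩ := x
  cases b
  · refine Prod.ext (Fin.ext ?_) ?_
    · change (2 * i.1 + 1) / 2 = i.1; omega
    · change decide ((2 * i.1 + 1) % 2 = 0) = false
      rw [decide_eq_false_iff_not]; omega
  · refine Prod.ext (Fin.ext ?_) ?_
    · change (2 * i.1 + 0) / 2 = i.1; omega
    · change decide ((2 * i.1 + 0) % 2 = 0) = true
      rw [decide_eq_true_iff]; omega

theorem monotone_fst_uninterleave : Monotone fun i : Fin (2 * n + 1 + 1) => (uninterleave i).1 :=
  fun _ _ h => Nat.div_le_div_right h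

/-- Here `(i, true)` has index `2i` and `(i, false)` has index `2i + 1`, so even where `θ`
identifies vertices, the switch from `true` to `false` does not decrease the index. Every shuffle
chain is thus a simplicial operator into one simplex of dimension `2n + 1`. -/
theorem monotone_interleave_shuffle (θ : Fin (m + 1) →o Fin (n + 1)) (k : Fin (m + 1)) :
    Monotone fun j => interleave (Prod.map θ id (shuffle k j)) := by
  intro i j hij
  have hij' : i.1 ≤ j.1 := hij
  simp only [shuffle]
  split_ifs with hi hj hj
  · have : (θ ⟨i.1, hi.trans_lt k.2⟩).1 ≤ (θ ⟨j.1, hj.trans_lt k.2⟩).1 := θ.monotone hij'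
    simp [interleave, this]
  · have : (θ ⟨i.1, hi.trans_lt k.2⟩).1 ≤ (θ ⟨j.1 - 1, by omega⟩).1 :=
      θ.monotone (Fin.le_def.2 (by simp; omega))
    simp [interleave, Fin.le_def]; omega
  · omega
  · have : (θ ⟨i.1 - 1, by omega⟩).1 ≤ (θ ⟨j.1 - 1, by omega⟩).1 :=
      θ.monotone (Fin.le_def.2 (by simp; omega))
    simp [interleave, this]

theorem monotone_interleave_const (b : Bool) :
    Monotone fun i : Fin (n + 1) => interleave (i, b) := by
  intro i j hij
  have : i.1 ≤ j.1 := hij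
  simp [interleave, this]

theorem split_zero (t : stdSimplex ℝ (Fin (n + 1))) :
    split t 0 = stdSimplex.map (fun i => (i, false)) t := by
  have h : ∀ i, cut t 0 i = 0 := fun i => by
    have h1 : 0 ≤ ∑ j ∈ Finset.Iio i, t j := Finset.sum_nonneg fun j _ => stdSimplex.zero_le t j
    have h2 := sum_Iic_eq t i
    have h3 := stdSimplex.zero_le t i
    rw [cut, min_eq_right (by linarith), min_eq_right h1, sub_self]
  ext ⟨i, b⟩
  rw [map_apply]
  cases b
  · simp [split_false, h, Finset.sum_filter]
  · simp [split_true, h]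

theorem split_one (t : stdSimplex ℝ (Fin (n + 1))) :
    split t 1 = stdSimplex.map (fun i => (i, true)) t := by
  have h : ∀ i, cut t 1 i = t i := fun i => by
    have h1 : ∑ j ∈ Finset.Iic i, t j ≤ 1 := by
      rw [← stdSimplex.sum_eq_one t]
      exact Finset.sum_le_sum_of_subset_of_nonneg (Finset.subset_univ _)
        fun j _ _ => stdSimplex.zero_le t j
    have h2 := sum_Iic_eq t i
    have h3 := stdSimplex.zero_le t i
    rw [cut, min_eq_left (by linarith), min_eq_left (by linarith)]
    linarith
  ext ⟨i, b⟩
  rw [map_apply]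
  cases b
  · simp [split_false, h]
  · simp [split_true, h, Finset.sum_filter]

end Cut

/-! ## Maps out of geometric realizations -/

section Realization

open Simplicial Opposite

variable {X Y : SSet.{u}} {n m : ℕ}

/-- The unit of the adjunction between realization and singular simplices. -/
noncomputable def realizationUnit (X : SSet.{u}) : X ⟶ TopCat.toSSet.obj (SSet.toTop.obj X) :=
  sSetTopAdj.unit.app X

/-- The characteristic map of a simplex of `X`, from the topological simplex to the geometric
realization. -/
noncomputable def characteristicMap (x : X _⦋n⦌) :
    C(stdSimplex ℝ (Fin (n + 1)), SSet.toTop.obj X) :=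
  TopCat.toSSetObjEquiv _ _ ((realizationUnit X).app (op ⦋n⦌) x)

theorem characteristicMap_map (θ : Fin (m + 1) →o Fin (n + 1)) (x : X _⦋n⦌)
    (t : stdSimplex ℝ (Fin (m + 1))) :
    characteristicMap (X.map (SimplexCategory.mkHom θ).op x) t =
      characteristicMap x (stdSimplex.map θ t) := by
  rw [characteristicMap, NatTrans.naturality_apply (realizationUnit X)]
  exact TopCat.toSSetObjEquiv_naturality_apply (SimplexCategory.mkHom θ)
    ((realizationUnit X).app (op ⦋n⦌) x) t

theorem toTop_map_characteristicMap (f : X ⟶ Y) (x : X _⦋n⦌)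
    (t : stdSimplex ℝ (Fin (n + 1))) :
    SSet.toTop.map f (characteristicMap x t) = characteristicMap (f.app _ x) t := by
  have h := ConcreteCategory.congr_hom
    (NatTrans.congr_app (sSetTopAdj.unit.naturality f) (op ⦋n⦌)) x
  exact (congrArg (fun a => TopCat.toSSetObjEquiv _ _ a t) h).symm

/-- A continuous map out of a geometric realization, from a compatible family of maps. -/
noncomputable def realizationDesc {Z : Type u} [TopologicalSpace Z]
    (φ : ∀ n, X _⦋n⦌ → C(stdSimplex ℝ (Fin (n + 1)), Z))
    (hφ : ∀ (m n : ℕ) (θ : Fin (m + 1) →o Fin (n + 1)) (x : X _⦋n⦌) t,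
      φ m (X.map (SimplexCategory.mkHom θ).op x) t = φ n x (stdSimplex.map θ t)) :
    C(SSet.toTop.obj X, Z) :=
  ((sSetTopAdj.homEquiv X (TopCat.of Z)).symm
    { app := fun k => ↾fun x => (TopCat.toSSetObjEquiv (TopCat.of Z) k).symm (φ k.unop.len x)
      naturality := by
        intro k l θ
        ext x
        refine (TopCat.toSSetObjEquiv (TopCat.of Z) l).injective (ContinuousMap.ext fun t => ?_)
        exact hφ l.unop.len k.unop.len θ.unop.toOrderHom x t }).hom

theorem realizationDesc_characteristicMap {Z : Type u} [TopologicalSpace Z]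
    (φ : ∀ n, X _⦋n⦌ → C(stdSimplex ℝ (Fin (n + 1)), Z))
    (hφ : ∀ (m n : ℕ) (θ : Fin (m + 1) →o Fin (n + 1)) (x : X _⦋n⦌) t,
      φ m (X.map (SimplexCategory.mkHom θ).op x) t = φ n x (stdSimplex.map θ t))
    (x : X _⦋n⦌) (t : stdSimplex ℝ (Fin (n + 1))) :
    realizationDesc φ hφ (characteristicMap x t) = φ n x t := by
  let ψ : X ⟶ TopCat.toSSet.obj (TopCat.of Z) :=
    { app := fun k => ↾fun x => (TopCat.toSSetObjEquiv (TopCat.of Z) k).symm (φ k.unop.len x)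
      naturality := by
        intro k l θ
        ext x
        refine (TopCat.toSSetObjEquiv (TopCat.of Z) l).injective (ContinuousMap.ext fun t => ?_)
        exact hφ l.unop.len k.unop.len θ.unop.toOrderHom x t }
  have h : sSetTopAdj.unit.app X ≫ TopCat.toSSet.map ((sSetTopAdj.homEquiv X _).symm ψ) = ψ := by
    exact (sSetTopAdj.homEquiv_unit _ _ _).symm.trans (Equiv.apply_symm_apply _ _)
  have h' := ConcreteCategory.congr_hom (NatTrans.congr_app h (op ⦋n⦌)) x
  have h'' := congrArg (fun a => TopCat.toSSetObjEquiv (TopCat.of Z) (op ⦋n⦌) a t) h'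
  exact h''

/-- Under the adjunction, a map out of the realization is a simplicial map into singular simplices,
and its values are the composites with characteristic maps. -/
theorem realization_hom_ext {Z : Type u} [TopologicalSpace Z] {f g : C(SSet.toTop.obj X, Z)}
    (h : ∀ (n : ℕ) (x : X _⦋n⦌) t, f (characteristicMap x t) = g (characteristicMap x t)) :
    f = g := by
  have e : TopCat.ofHom f = (TopCat.ofHom g : SSet.toTop.obj X ⟶ TopCat.of Z) := by
    refine (sSetTopAdj.homEquiv X (TopCat.of Z)).injective ?_
    rw [Adjunction.homEquiv_unit, Adjunction.homEquiv_unit]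
    ext k x
    refine (TopCat.toSSetObjEquiv (TopCat.of Z) k).injective (ContinuousMap.ext fun t => ?_)
    exact h k.unop.len x t
  exact congrArg TopCat.Hom.hom e

end Realization

/-! ## Natural isomorphisms induce homotopies -/

theorem monotone_fst_shuffle {m : ℕ} (k : Fin (m + 1)) : Monotone fun j => (shuffle k j).1 := by
  intro i j hij
  have hij' : i.1 ≤ j.1 := hij
  simp only [shuffle, Fin.le_def]
  split_ifs <;> simp <;> omega

/-! ### The cylinder `C × {0 ≅ 1}` and its canonical homotopy. -/

section Cylinder

open Simplicial Opposite

/-- The groupoid with two objects and exactly one morphism between any two objects. -/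
abbrev WalkingIsoBool := Codiscrete Bool

variable {C D : Type u} [Category.{v} C] [Category.{v} D] {n m : ℕ}

/-- The functor given by `uninterleave`. -/
def uninterleaveFunctor (n : ℕ) : Fin (2 * n + 1 + 1) ⥤ Fin (n + 1) × WalkingIsoBool :=
  (monotone_fst_uninterleave (n := n)).functor.prod'
    (Codiscrete.functor fun i => (uninterleave i).2)

theorem uninterleaveFunctor_obj (x : Fin (n + 1) × Bool) :
    (uninterleaveFunctor n).obj (interleave x) = (x.1, ⟨x.2⟩) := by
  have h := uninterleave_interleave x
  change ((uninterleave (interleave x)).1, Codiscrete.mk (uninterleave (interleave x)).2) = _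
  rw [h]

/-- The functor given by `shuffle`. -/
def shuffleFunctor (k : Fin (m + 1)) : Fin (m + 1 + 1) ⥤ Fin (m + 1) × WalkingIsoBool :=
  (monotone_fst_shuffle k).functor.prod' (Codiscrete.functor fun i => (shuffle k i).2)

/-- The interleaved chain of a chain in `C` in the cylinder on `C`. -/
def prism (s : ComposableArrows C n) : ComposableArrows (C × WalkingIsoBool) (2 * n + 1) :=
  uninterleaveFunctor n ⋙ s.prod (𝟭 WalkingIsoBool)

theorem functor_ext_of_thin {A B : Type*} [Category A] [Category B] [Quiver.IsThin B]
    {F K : A ⥤ B} (h : ∀ X, F.obj X = K.obj X) : F = K :=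
  CategoryTheory.Functor.ext h fun _ _ _ => Subsingleton.elim _ _

instance : Quiver.IsThin (Fin (n + 1) × WalkingIsoBool) := fun _ _ =>
  ⟨fun _ _ => Prod.ext (Subsingleton.elim _ _) rfl⟩

/-- The map from a topological simplex to `BC` given by a chain in `C`. -/
noncomputable def chainMap (s : ComposableArrows C n) :
    C(stdSimplex ℝ (Fin (n + 1)), ClassifyingSpace C) :=
  characteristicMap (X := nerve C) s

theorem chainMap_comp (θ : Fin (m + 1) →o Fin (n + 1)) (s : ComposableArrows C n)
    (t : stdSimplex ℝ (Fin (m + 1))) :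
    chainMap (θ.monotone.functor ⋙ s : ComposableArrows C m) t =
      chainMap s (stdSimplex.map θ t) :=
  characteristicMap_map (X := nerve C) θ s t

theorem classifyingMap_chainMap (F : C ⥤ D) (s : ComposableArrows C n)
    (t : stdSimplex ℝ (Fin (n + 1))) :
    classifyingMap F (chainMap s t) = chainMap (s ⋙ F : ComposableArrows D n) t :=
  toTop_map_characteristicMap (nerveMap F) s t

theorem classifyingSpace_hom_ext {Z : Type (max u v)} [TopologicalSpace Z]
    {f g : C(ClassifyingSpace C, Z)}
    (h : ∀ (n : ℕ) (s : ComposableArrows C n) t, f (chainMap s t) = g (chainMap s t)) : f = g :=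
  realization_hom_ext (X := nerve C) h

/-- Since `Fin (n + 1) × WalkingIsoBool` is thin, a chain in it is determined by its vertices. The
interleaved chain alternates between the two ends, which is possible because they are joined by an
isomorphism. -/
theorem chainMap_prism (θ : Fin (m + 1) →o Fin (2 * n + 1 + 1)) (s : ComposableArrows C n)
    {K : Fin (m + 1) ⥤ Fin (n + 1) × WalkingIsoBool}
    (hK : ∀ i, (uninterleaveFunctor n).obj (θ i) = K.obj i) (t : stdSimplex ℝ (Fin (m + 1))) :
    chainMap (prism s) (stdSimplex.map θ t) =
      chainMap (K ⋙ s.prod (𝟭 WalkingIsoBool) : ComposableArrows (C × WalkingIsoBool) m) t := by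
  have e : θ.monotone.functor ⋙ uninterleaveFunctor n = K := functor_ext_of_thin hK
  rw [← e]
  exact (chainMap_comp θ (prism s) t).symm

/-- The path of points of the cylinder over a point of a simplex. -/
noncomputable def prismMap (s : ComposableArrows C n) :
    C(stdSimplex ℝ (Fin (n + 1)), C(I, ClassifyingSpace (C × WalkingIsoBool))) :=
  ContinuousMap.curry
    ⟨fun z => chainMap (prism s) (stdSimplex.map interleave (split z.1 z.2)),
      (ContinuousMap.continuous _).comp ((stdSimplex.continuous_map _).comp continuous_split)⟩

theorem prismMap_apply (s : ComposableArrows C n) (t : stdSimplex ℝ (Fin (n + 1))) (c : I) :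
    prismMap s t c = chainMap (prism s) (stdSimplex.map interleave (split t c)) := rfl

/-- The point `split t c` lies on some shuffle simplex. On it both sides are given by the same chain
of the cylinder, although they use interleaved simplices of different dimensions. -/
theorem prismMap_comp (θ : Fin (m + 1) →o Fin (n + 1)) (s : ComposableArrows C n)
    (t : stdSimplex ℝ (Fin (m + 1))) :
    prismMap (θ.monotone.functor ⋙ s : ComposableArrows C m) t =
      prismMap s (stdSimplex.map θ t) := by
  refine ContinuousMap.ext fun c => ?_
  obtain ⟨k, hk⟩ := exists_shuffle t c
  let a : Fin (m + 1 + 1) →o Fin (2 * m + 1 + 1) :=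
    ⟨fun j => interleave (shuffle k j), monotone_interleave_shuffle OrderHom.id k⟩
  let b : Fin (m + 1 + 1) →o Fin (2 * n + 1 + 1) :=
    ⟨fun j => interleave (Prod.map θ id (shuffle k j)), monotone_interleave_shuffle θ k⟩
  generalize stdSimplex.map flatten (split t c) = w at hk
  rw [prismMap_apply, prismMap_apply, split_map, ← hk, stdSimplex.map_comp_apply,
    stdSimplex.map_comp_apply, stdSimplex.map_comp_apply]
  have ha := chainMap_prism a (θ.monotone.functor ⋙ s : ComposableArrows C m)
    (K := (shuffleFunctor k)) (fun j => uninterleaveFunctor_obj (shuffle k j)) w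
  have hb := chainMap_prism b s (K := shuffleFunctor k ⋙ θ.monotone.functor.prod (𝟭 _))
    (fun j => uninterleaveFunctor_obj (Prod.map θ id (shuffle k j))) w
  exact ha.trans hb.symm

/-- The canonical map `BC → Map(I, B(C × {0 ≅ 1}))`. -/
noncomputable def cylinderMap (C : Type u) [Category.{v} C] :
    C(ClassifyingSpace C, C(I, ClassifyingSpace (C × WalkingIsoBool))) :=
  realizationDesc (X := nerve C) (fun _ s => prismMap s) (fun _ _ θ s t => prismMap_comp θ s t)

theorem cylinderMap_chainMap (s : ComposableArrows C n) (t : stdSimplex ℝ (Fin (n + 1))) :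
    cylinderMap C (chainMap s t) = prismMap s t :=
  realizationDesc_characteristicMap (X := nerve C) (fun _ s => prismMap s)
    (fun _ _ θ s t => prismMap_comp θ s t) s t

theorem cylinderMap_naturality (F : C ⥤ D) (x : ClassifyingSpace C) (c : I) :
    cylinderMap D (classifyingMap F x) c =
      classifyingMap (F.prod (𝟭 WalkingIsoBool)) (cylinderMap C x c) := by
  have h : (cylinderMap D).comp (classifyingMap F) =
      (⟨_, ContinuousMap.continuous_postcomp (classifyingMap (F.prod (𝟭 WalkingIsoBool)))⟩ :
        C(C(I, _), C(I, _))).comp (cylinderMap C) := by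
    refine classifyingSpace_hom_ext fun n s t => ContinuousMap.ext fun c => ?_
    change cylinderMap D (classifyingMap F (chainMap s t)) c =
      classifyingMap (F.prod (𝟭 WalkingIsoBool)) (cylinderMap C (chainMap s t) c)
    rw [classifyingMap_chainMap, cylinderMap_chainMap, cylinderMap_chainMap, prismMap_apply,
      prismMap_apply, classifyingMap_chainMap]
    rfl
  exact congrArg (fun f => f x c) h

/-- The inclusion of `C` at one end of the cylinder. -/
def endInclusion (C : Type u) [Category.{v} C] (b : Bool) : C ⥤ C × WalkingIsoBool :=
  (𝟭 C).prod' (Codiscrete.functor fun _ => b)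

/-- The hypothesis `hc` holds for `c = 0` with `b = false` and for `c = 1` with `b = true`; the
chain then stays at one end. -/
theorem cylinderMap_end (b : Bool) (c : I) (hc : ∀ (n : ℕ) (t : stdSimplex ℝ (Fin (n + 1))),
    split t c = stdSimplex.map (fun i => (i, b)) t) (x : ClassifyingSpace C) :
    cylinderMap C x c = classifyingMap (endInclusion C b) x := by
  have h : (ContinuousMap.mk (fun f : C(I, ClassifyingSpace (C × WalkingIsoBool)) => f c)
      (by fun_prop)).comp (cylinderMap C) = classifyingMap (endInclusion C b) := by
    refine classifyingSpace_hom_ext fun n s t => ?_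
    change cylinderMap C (chainMap s t) c = _
    rw [classifyingMap_chainMap, cylinderMap_chainMap, prismMap_apply, hc,
      stdSimplex.map_comp_apply]
    exact chainMap_prism ⟨fun i : Fin (n + 1) => interleave (i, b), monotone_interleave_const b⟩ s
      (K := (𝟭 _).prod' (Codiscrete.functor fun _ => b))
      (fun j => uninterleaveFunctor_obj (j, b)) t
  exact congrArg (fun f => f x) h

end Cylinder

/-! ## Heterogeneous equality of morphisms -/

section HEq

variable {C : Type u₁} [Category.{v₁} C] {D : Type u₂} [Category.{v₂} D]

theorem comp_heq {X X' Y Y' Z Z' : C} (hX : X = X') (hY : Y = Y') (hZ : Z = Z') {f : X ⟶ Y}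
    {f' : X' ⟶ Y'} {g : Y ⟶ Z} {g' : Y' ⟶ Z'} (hf : HEq f f') (hg : HEq g g') :
    HEq (f ≫ g) (f' ≫ g') := by
  subst hX hY hZ hf hg; rfl

theorem map_heq (F : C ⥤ D) {X X' Y Y' : C} (hX : X = X') (hY : Y = Y') {f : X ⟶ Y}
    {f' : X' ⟶ Y'} (hf : HEq f f') : HEq (F.map f) (F.map f') := by
  subst hX hY hf; rfl

theorem inv_heq {X X' Y Y' : C} (hX : X = X') (hY : Y = Y') {e : X ≅ Y} {e' : X' ≅ Y'}
    (h : HEq e.hom e'.hom) : HEq e.inv e'.inv := by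
  subst hX hY
  rw [Iso.ext (eq_of_heq h)]

theorem heq_of_map_heq (F : C ⥤ D) [F.Faithful] {X X' Y Y' : C} (hX : X = X') (hY : Y = Y')
    {f : X ⟶ Y} {f' : X' ⟶ Y'} (h : HEq (F.map f) (F.map f')) : HEq f f' := by
  subst hX hY
  exact heq_of_eq (F.map_injective (eq_of_heq h))

theorem functor_map_heq {F K : C ⥤ D} (h : F = K) {X Y : C} (f : X ⟶ Y) :
    HEq (F.map f) (K.map f) := by
  rw [h]

end HEq

/-! ## The homotopy of a natural isomorphism -/

section Homotopy

variable {C D : Type u} [Category.{v} C] [Category.{v} D] {F K : C ⥤ D}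

/-- The value at the ends of the cylinder of the functor given by a natural isomorphism. -/
def cylinderObj (F K : C ⥤ D) (X : C × WalkingIsoBool) : D :=
  bif X.2.as then K.obj X.1 else F.obj X.1

/-- The objects at the two ends are isomorphic. -/
def cylinderIso (α : F ≅ K) : ∀ X : C × WalkingIsoBool, F.obj X.1 ≅ cylinderObj F K X
  | (_, ⟨false⟩) => Iso.refl _
  | (X, ⟨true⟩) => α.app X

/-- The functor on the cylinder given by a natural isomorphism. -/
def cylinderFunctor (α : F ≅ K) : C × WalkingIsoBool ⥤ D :=
  (CategoryTheory.Prod.fst C WalkingIsoBool ⋙ F).copyObj (cylinderObj F K) (cylinderIso α)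

theorem endInclusion_false_comp (α : F ≅ K) : endInclusion C false ⋙ cylinderFunctor α = F :=
  Functor.hext (fun _ => rfl) fun X Y f => heq_of_eq <| by
    change 𝟙 _ ≫ F.map f ≫ 𝟙 _ = _
    rw [Category.id_comp, Category.comp_id]

theorem endInclusion_true_comp (α : F ≅ K) : endInclusion C true ⋙ cylinderFunctor α = K :=
  Functor.hext (fun _ => rfl) fun X Y f => heq_of_eq <| by
    change α.inv.app X ≫ F.map f ≫ α.hom.app Y = _
    simp

/-- A natural isomorphism induces a homotopy between maps of classifying spaces. -/
noncomputable def natIsoHomotopy (α : F ≅ K) : (classifyingMap F).Homotopy (classifyingMap K) where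
  toFun z := classifyingMap (cylinderFunctor α) (cylinderMap C z.2 z.1)
  continuous_toFun := by fun_prop
  map_zero_left x := by
    rw [cylinderMap_end false 0 (fun _ t => split_zero t), ← classifyingMap_comp,
      endInclusion_false_comp]
  map_one_left x := by
    rw [cylinderMap_end true 1 (fun _ t => split_one t), ← classifyingMap_comp,
      endInclusion_true_comp]

/-- The cylinder functor is `F` conjugated by the isomorphisms `cylinderIso α`. These are identities
at one end and components of `α` at the other, so `b` carries them to each other. -/
theorem cylinderFunctor_comp (α : F ≅ K) (a : C ⥤ C) (b : D ⥤ D) (hF : a ⋙ F = F ⋙ b)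
    (hK : a ⋙ K = K ⋙ b) (hα : ∀ X, HEq (b.map (α.hom.app X)) (α.hom.app (a.obj X))) :
    a.prod (𝟭 WalkingIsoBool) ⋙ cylinderFunctor α = cylinderFunctor α ⋙ b := by
  have ho : ∀ X : C × WalkingIsoBool,
      cylinderObj F K (a.obj X.1, X.2) = b.obj (cylinderObj F K X) := by
    rintro ⟨X, ⟨_ | _⟩⟩
    · exact Functor.congr_obj hF X
    · exact Functor.congr_obj hK X
  have hi : ∀ X : C × WalkingIsoBool,
      HEq (cylinderIso α (a.obj X.1, X.2)).hom (b.mapIso (cylinderIso α X)).hom := by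
    rintro ⟨X, ⟨_ | _⟩⟩
    · have e : (𝟙 (F.obj (a.obj X)) : _) ≍ b.map (𝟙 (F.obj X)) := by
        rw [b.map_id]
        exact congr_arg_heq (fun Y => 𝟙 Y) (Functor.congr_obj hF X)
      exact e
    · exact (hα X).symm
  refine Functor.hext ho fun X Y f => ?_
  have hm : HEq (F.map (a.map f.1)) (b.map (F.map f.1)) := functor_map_heq hF f.1
  have e : (cylinderFunctor α ⋙ b).map f = (b.mapIso (cylinderIso α X)).inv ≫
      b.map (F.map f.1) ≫ (b.mapIso (cylinderIso α Y)).hom := by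
    simp [cylinderFunctor, Functor.copyObj]
  rw [e]
  exact comp_heq (ho X) (Functor.congr_obj hF X.1) (ho Y)
    (inv_heq (Functor.congr_obj hF X.1) (ho X) (hi X))
    (comp_heq (Functor.congr_obj hF X.1) (Functor.congr_obj hF Y.1) (ho Y) hm (hi Y))

theorem natIsoHomotopy_naturality (α : F ≅ K) (a : C ⥤ C) (b : D ⥤ D) (hF : a ⋙ F = F ⋙ b)
    (hK : a ⋙ K = K ⋙ b) (hα : ∀ X, HEq (b.map (α.hom.app X)) (α.hom.app (a.obj X)))
    (t : I) (x : ClassifyingSpace C) :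
    natIsoHomotopy α (t, classifyingMap a x) = classifyingMap b (natIsoHomotopy α (t, x)) := by
  change classifyingMap (cylinderFunctor α) (cylinderMap C (classifyingMap a x) t) =
    classifyingMap b (classifyingMap (cylinderFunctor α) (cylinderMap C x t))
  rw [cylinderMap_naturality, ← classifyingMap_comp, ← classifyingMap_comp,
    cylinderFunctor_comp α a b hF hK hα]

end Homotopy

/-! ## Equivalences of `G`-categories -/

/-- An equivalence of `G`-categories in which both functors and both natural isomorphisms are
strictly equivariant. -/
structure GEquivalence (G : Type w) [Group G] (C : Type u₁) [Category.{v₁} C] [GCategory G C]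
    (D : Type u₂) [Category.{v₂} D] [GCategory G D] where
  functor : C ⥤ D
  inverse : D ⥤ C
  functor_equivariant : IsEquivariant G functor
  inverse_equivariant : IsEquivariant G inverse
  unit : functor ⋙ inverse ≅ 𝟭 C
  counit : inverse ⋙ functor ≅ 𝟭 D
  act_unit : ∀ (g : G) (X : C),
    HEq ((act g).map (unit.hom.app X)) (unit.hom.app ((act g).obj X))
  act_counit : ∀ (g : G) (Y : D),
    HEq ((act g).map (counit.hom.app Y)) (counit.hom.app ((act g).obj Y))

namespace GEquivalence

section General

variable {G : Type w} [Group G] {C : Type u₁} [Category.{v₁} C] [GCategory G C]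
  {D : Type u₂} [Category.{v₂} D] [GCategory G D]

theorem isEquivalence_functor (E : GEquivalence G C D) : E.functor.IsEquivalence :=
  (CategoryTheory.Equivalence.mk E.functor E.inverse E.unit.symm E.counit).isEquivalence_functor

/-- Faithfulness makes the preimage of a fixed morphism fixed. The strict inverse sends fixed
objects to fixed objects, and strict equivariance of the counit makes the comparison isomorphism a
morphism of the fixed category. -/
theorem isEquivalence_fixedFunctor (E : GEquivalence G C D) (H : Subgroup G) :
    (fixedFunctor E.functor E.functor_equivariant H).IsEquivalence := by
  have := E.isEquivalence_functor
  refine ⟨⟨fun h => ?_⟩, ⟨fun f => ?_⟩, ⟨fun Y => ?_⟩⟩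
  · exact Subtype.ext (E.functor.map_injective (congrArg Subtype.val h))
  · rename_i X Y
    obtain ⟨p, hp⟩ : ∃ p : X.obj ⟶ Y.obj, E.functor.map p = f.1 := E.functor.map_surjective _
    refine ⟨⟨p, fun h hh => ?_⟩, Subtype.ext hp⟩
    refine heq_of_map_heq E.functor (X.fixed h hh) (Y.fixed h hh) ?_
    refine (functor_map_heq (E.functor_equivariant h) p).trans ?_
    exact (heq_of_eq (congrArg (act h).map hp)).trans ((f.2 h hh).trans (heq_of_eq hp.symm))
  · have hX : ∀ h ∈ H, (act h).obj (E.inverse.obj Y.obj) = E.inverse.obj Y.obj := fun h hh =>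
      (Functor.congr_obj (E.inverse_equivariant h) Y.obj).symm.trans
        (congrArg E.inverse.obj (Y.fixed h hh))
    let X : FixedCategory H C := ⟨E.inverse.obj Y.obj, hX⟩
    have hc : ∀ h ∈ H, HEq ((act h).map (E.counit.hom.app Y.obj)) (E.counit.hom.app Y.obj) :=
      fun h hh => (E.act_counit h Y.obj).trans (congr_arg_heq _ (Y.fixed h hh))
    have hX' := ((fixedFunctor E.functor E.functor_equivariant H).obj X).fixed
    refine ⟨X, ⟨⟨⟨E.counit.hom.app Y.obj, hc⟩, ⟨E.counit.inv.app Y.obj, fun h hh => ?_⟩,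
      Subtype.ext (E.counit.hom_inv_id_app Y.obj),
      Subtype.ext (E.counit.inv_hom_id_app Y.obj)⟩⟩⟩
    exact inv_heq (e := (act h).mapIso (E.counit.app Y.obj)) (e' := E.counit.app Y.obj)
      (hX' h hh) (Y.fixed h hh) (hc h hh)

/-- A fully faithful equivariant functor with an equivariant choice of preimages of objects up to
isomorphism is an equivalence of `G`-categories. -/
noncomputable def ofFullyFaithful (F : C ⥤ D) (hF : IsEquivariant G F) [F.Full] [F.Faithful]
    (obj : D → C) (hobj : ∀ (g : G) (Y : D), obj ((act g).obj Y) = (act g).obj (obj Y))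
    (ε : ∀ Y, F.obj (obj Y) ≅ Y)
    (hε : ∀ (g : G) (Y : D), HEq ((act g).map (ε Y).hom) (ε ((act g).obj Y)).hom) :
    GEquivalence G C D :=
  let K : D ⥤ C :=
    { obj := obj
      map := fun {X Y} f => F.preimage ((ε X).hom ≫ f ≫ (ε Y).inv)
      map_id := fun X => F.map_injective (by simp)
      map_comp := fun f g => F.map_injective (by simp) }
  let c : K ⋙ F ≅ 𝟭 D := NatIso.ofComponents ε (by simp [K])
  have hFo : ∀ (g : G) (X : C), F.obj ((act g).obj X) = (act g).obj (F.obj X) := fun g X =>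
    Functor.congr_obj (hF g) X
  have hFK : ∀ (g : G) (Y : D), F.obj (obj ((act g).obj Y)) = (act g).obj (F.obj (obj Y)) :=
    fun g Y => (congrArg F.obj (hobj g Y)).trans (hFo g (obj Y))
  { functor := F
    inverse := K
    functor_equivariant := hF
    inverse_equivariant := fun g => Functor.hext (hobj g) fun X Y f => by
      refine heq_of_map_heq F (hobj g X) (hobj g Y) ?_
      refine HEq.trans ?_ (functor_map_heq (hF g) (K.map f)).symm
      change HEq (F.map (F.preimage _)) ((act g).map (F.map (F.preimage _)))
      rw [F.map_preimage, F.map_preimage, Functor.map_comp, Functor.map_comp]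
      refine comp_heq (hFK g X) rfl (hFK g Y) (hε g X).symm (comp_heq rfl rfl (hFK g Y) HEq.rfl ?_)
      exact (inv_heq (e := (act g).mapIso (ε Y)) (hFK g Y).symm rfl (hε g Y)).symm
    unit := NatIso.ofComponents (fun X => F.preimageIso (ε (F.obj X))) fun f =>
      F.map_injective (by simp [K])
    counit := c
    act_counit := hε
    -- The functor `F` sends the unit at `X` to `ε (F.obj X)`, so equivariance of `ε` suffices by
    -- faithfulness.
    act_unit := fun g X => by
      have h1 : obj (F.obj ((act g).obj X)) = (act g).obj (obj (F.obj X)) := by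
        rw [hFo, hobj]
      refine heq_of_map_heq F h1.symm rfl ?_
      refine (functor_map_heq (hF g) _).trans ?_
      change HEq ((act g).map (F.map (F.preimage _))) (F.map (F.preimage _))
      rw [F.map_preimage, F.map_preimage]
      refine (hε g (F.obj X)).trans ?_
      exact congr_arg_heq (fun Y => (ε Y).hom) (hFo g X).symm }

end General

section ClassifyingSpace

variable {G : Type w} [Group G] {C D : Type u} [Category.{v} C] [GCategory G C]
  [Category.{v} D] [GCategory G D]

theorem classifyingMap_smul {F : C ⥤ D} (hF : IsEquivariant G F) (g : G)
    (x : ClassifyingSpace C) : classifyingMap F (g • x) = g • classifyingMap F x := by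
  change classifyingMap F (classifyingMap (act g) x) = classifyingMap (act g) (classifyingMap F x)
  rw [← classifyingMap_comp, ← classifyingMap_comp, hF g]

theorem isEquivariant_comp {E : Type u₂} [Category.{v₂} E] [GCategory G E] {F : C ⥤ D}
    {K : D ⥤ E} (hF : IsEquivariant G F) (hK : IsEquivariant G K) : IsEquivariant G (F ⋙ K) :=
  fun g => by rw [← Functor.assoc, hF g, Functor.assoc, hK g, Functor.assoc]

/-- Equivalent `G`-categories have `G`-homotopy equivalent classifying spaces. -/
noncomputable def gHomotopyEquiv (E : GEquivalence G C D) :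
    GHomotopyEquiv G (ClassifyingSpace C) (ClassifyingSpace D) where
  toFun := classifyingMap E.functor
  invFun := classifyingMap E.inverse
  toFun_smul := classifyingMap_smul E.functor_equivariant
  invFun_smul := classifyingMap_smul E.inverse_equivariant
  left := (natIsoHomotopy E.unit).cast
    (ContinuousMap.ext fun x => (classifyingMap_comp E.functor E.inverse x))
    (ContinuousMap.ext fun x => (classifyingMap_id C x))
  right := (natIsoHomotopy E.counit).cast
    (ContinuousMap.ext fun x => (classifyingMap_comp E.inverse E.functor x))
    (ContinuousMap.ext fun x => (classifyingMap_id D x))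
  left_smul g t x := natIsoHomotopy_naturality E.unit (act g) (act g)
    (isEquivariant_comp E.functor_equivariant E.inverse_equivariant g) rfl (E.act_unit g) t x
  right_smul g t x := natIsoHomotopy_naturality E.counit (act g) (act g)
    (isEquivariant_comp E.inverse_equivariant E.functor_equivariant g) rfl (E.act_counit g) t x

end ClassifyingSpace

end GEquivalence

/-! ## `G`-homotopy equivalences are weak `G`-equivalences -/

/-- The restriction to fixed points of a homotopy through `G`-maps. -/
def fixedPointsHomotopy {G : Type w} [Group G] {X : Type u₁} [TopologicalSpace X] [MulAction G X]
    {φ : C(X, X)} (hφ : ∀ (g : G) (x : X), φ (g • x) = g • φ x)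
    (H : φ.Homotopy (ContinuousMap.id X)) (hH : ∀ (g : G) (t : I) (x : X),
      H (t, g • x) = g • H (t, x)) (K : Subgroup G) :
    (fixedPointsMap φ hφ K).Homotopy (ContinuousMap.id _) where
  toFun z := ⟨H (z.1, z.2.1), fun k => (hH k.1 z.1 z.2.1).symm.trans
    (congrArg (fun x => H (z.1, x)) (z.2.2 k))⟩
  continuous_toFun := by fun_prop
  map_zero_left x := Subtype.ext (H.apply_zero x.1)
  map_one_left x := Subtype.ext (H.apply_one x.1)

/-- Homotopies through `G`-maps preserve the fixed points of each subgroup, so they restrict to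
ordinary homotopies there. -/
theorem GHomotopyEquiv.isWeakGEquivalence {G : Type w} [Group G] {X : Type u₁} {Y : Type u₂}
    [TopologicalSpace X] [TopologicalSpace Y] [MulAction G X] [MulAction G Y]
    (E : GHomotopyEquiv G X Y) : IsWeakGEquivalence G E.toFun :=
  ⟨E.toFun_smul, fun K => isWeakHomotopyEquivalence_of_homotopy _
    (fixedPointsMap E.invFun E.invFun_smul K)
    (fixedPointsHomotopy
      (fun g x => (congrArg E.invFun (E.toFun_smul g x)).trans (E.invFun_smul g _))
      E.left E.left_smul K)
    (fixedPointsHomotopy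
      (fun g x => (congrArg E.toFun (E.invFun_smul g x)).trans (E.toFun_smul g _))
      E.right E.right_smul K)⟩

/-! ## Pseudo equivariant functors induce equivariant functors on `Cat(G̃, -)` -/

section Basic

variable {G : Type w} [Group G] {C : Type u₁} [Category.{v₁} C] [GCategory G C]

theorem act_act_inv_obj (x : G) (Z : C) : (act x).obj ((act x⁻¹).obj Z) = Z := by
  rw [← act_mul_obj, mul_inv_cancel, act_one_obj]

theorem act_inv_act_obj {x g h : G} (hx : x = g * h) (Z : C) :
    (act x⁻¹).obj ((act g).obj Z) = (act h⁻¹).obj Z := by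
  rw [← act_mul_obj, hx, mul_inv_rev, inv_mul_cancel_right]

theorem act_eq_act_act {x g h : G} (hx : x = g * h) (Z : C) :
    (act x).obj Z = (act g).obj ((act h).obj Z) := by
  rw [hx, act_mul_obj]

theorem act_map_heq {x g h : G} (hx : x = g * h) {Z Z' : C} (f : Z ⟶ Z') :
    HEq ((act x).map f) ((act g).map ((act h).map f)) := by
  subst hx
  exact act_mul_map_heq g h f

end Basic

namespace PseudoEquivariantFunctor

variable {G : Type w} [Group G] {C : Type u₁} [Category.{v₁} C] [GCategory G C]
  {D : Type u₂} [Category.{v₂} D] [GCategory G D] (Θ : PseudoEquivariantFunctor G C D)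

/-- The cocycle condition, with `y` in place of `g y`. -/
theorem θ_mul_heq {x g h : G} (hx : x = g * h) (Z : C) :
    HEq ((Θ.θ x).hom.app Z)
      ((Θ.θ g).hom.app ((act h).obj Z) ≫ (act g).map ((Θ.θ h).hom.app Z)) := by
  subst hx
  rw [Θ.θ_mul]
  refine (eqToHom_comp_heq _ _).trans ?_
  rw [← Category.assoc]
  exact comp_eqToHom_heq _ _

theorem act_functor_map (g : G) {Z Z' : C} (f : Z ⟶ Z') :
    (act g).map (Θ.functor.map f) =
      (Θ.θ g).inv.app Z ≫ Θ.functor.map ((act g).map f) ≫ (Θ.θ g).hom.app Z' :=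
  (NatIso.naturality_1 (Θ.θ g) f).symm

/-- The object `x Θ(x⁻¹ Z)`. -/
def conjObj (x : G) (Z : C) : D := (act x).obj (Θ.functor.obj ((act x⁻¹).obj Z))

/-- From `x = g h` one gets `x⁻¹ g = h⁻¹`. The factorization is a hypothesis because it is used with
`h = g⁻¹ x`, where `g * h` is not syntactically `x`. -/
theorem conjObj_act {x g h : G} (hx : x = g * h) (Z : C) :
    Θ.conjObj x ((act g).obj Z) = (act g).obj (Θ.conjObj h Z) := by
  rw [conjObj, act_inv_act_obj hx, act_eq_act_act hx]; rfl

/-- The isomorphism `Θ(Z) ≅ x Θ(x⁻¹ Z)`. -/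
def conjIso (x : G) (Z : C) : Θ.functor.obj Z ≅ Θ.conjObj x Z :=
  eqToIso (congrArg Θ.functor.obj (act_act_inv_obj x Z).symm) ≪≫ (Θ.θ x).app ((act x⁻¹).obj Z)

/-- This is the cocycle condition at `h⁻¹ Z`: `θ_g` followed by `g θ_h` is `θ_x`. -/
theorem conjIso_act {x g h : G} (hx : x = g * h) (Z : C) :
    HEq ((Θ.θ g).hom.app Z ≫ (act g).map (Θ.conjIso h Z).hom)
      (Θ.conjIso x ((act g).obj Z)).hom := by
  -- With `h⁻¹ Z` replaced by a variable `W`, the equation `Z = h W` can be eliminated.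
  have key : ∀ (W Z : C) (e : Θ.functor.obj Z = Θ.functor.obj ((act h).obj W))
      (_ : Z = (act h).obj W), HEq ((Θ.θ g).hom.app Z ≫ (act g).map (eqToHom e ≫
        (Θ.θ h).hom.app W)) ((Θ.θ x).hom.app W) := by
    rintro W _ e rfl
    rw [eqToHom_refl, Category.id_comp]
    exact (Θ.θ_mul_heq hx W).symm
  refine (key _ _ (congrArg Θ.functor.obj (act_act_inv_obj h Z).symm)
    (act_act_inv_obj h Z).symm).trans ?_
  refine HEq.trans ?_ (eqToHom_comp_heq _
    (congrArg Θ.functor.obj (act_act_inv_obj x ((act g).obj Z)).symm)).symm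
  exact (congr_arg_heq (fun W => (Θ.θ x).hom.app W) (act_inv_act_obj hx Z)).symm

/-- The morphism `x Θ(x⁻¹ Z) ⟶ y Θ(y⁻¹ Z')` corresponding to `Θ(f)`. -/
def conjMap (x y : G) {Z Z' : C} (f : Z ⟶ Z') : Θ.conjObj x Z ⟶ Θ.conjObj y Z' :=
  (Θ.conjIso x Z).inv ≫ Θ.functor.map f ≫ (Θ.conjIso y Z').hom

theorem conjMap_act {x y g h k : G} (hx : x = g * h) (hy : y = g * k) {Z Z' : C} (f : Z ⟶ Z') :
    HEq (Θ.conjMap x y ((act g).map f)) ((act g).map (Θ.conjMap h k f)) := by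
  have e : (act g).map (Θ.conjMap h k f) =
      ((Θ.θ g).app Z ≪≫ (act g).mapIso (Θ.conjIso h Z)).inv ≫ Θ.functor.map ((act g).map f) ≫
        ((Θ.θ g).app Z' ≪≫ (act g).mapIso (Θ.conjIso k Z')).hom := by
    simp [conjMap, act_functor_map]
  rw [e]
  exact comp_heq (Θ.conjObj_act hx Z) rfl (Θ.conjObj_act hy Z')
    (inv_heq rfl (Θ.conjObj_act hx Z) (Θ.conjIso_act hx Z).symm)
    (comp_heq rfl rfl (Θ.conjObj_act hy Z') HEq.rfl (Θ.conjIso_act hy Z').symm)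

/-- The equivariant functor `Cat(G̃, C) ⥤ Cat(G̃, D)` sending `X` to `x ↦ x Θ(x⁻¹ X(x))`. -/
def catTilde : CatTilde G C ⥤ CatTilde G D :=
  ((Functor.whiskeringRight (Codiscrete G) C D).obj Θ.functor).copyObj
    (fun X => (X ⋙ Θ.functor).copyObj (fun x => Θ.conjObj x.as (X.obj x))
      (fun x => Θ.conjIso x.as (X.obj x)))
    (fun _ => Functor.isoCopyObj _ _ _)

/-- `catTilde` is isomorphic to composition with `Θ`. -/
def whiskeringIsoCatTilde :
    (Functor.whiskeringRight (Codiscrete G) C D).obj Θ.functor ≅ Θ.catTilde :=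
  Functor.isoCopyObj _ _ _

/-- At `x`, the functor `gX` has value `g X(g⁻¹ x)`; the preceding lemmas apply with `h = g⁻¹ x`. -/
theorem catTilde_act_obj (g : G) (X : CatTilde G C) :
    Θ.catTilde.obj ((act g).obj X) = (act g).obj (Θ.catTilde.obj X) :=
  Functor.hext (fun x => Θ.conjObj_act (mul_inv_cancel_left g x.as).symm _)
    (fun x y _ => Θ.conjMap_act (mul_inv_cancel_left g x.as).symm
      (mul_inv_cancel_left g y.as).symm _)

theorem catTilde_equivariant : IsEquivariant G Θ.catTilde := fun g =>
  Functor.hext (Θ.catTilde_act_obj g) fun X Y _ =>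
    natTrans_heq (Θ.catTilde_act_obj g X) (Θ.catTilde_act_obj g Y) _ _ fun x =>
      Θ.conjMap_act (mul_inv_cancel_left g x.as).symm (mul_inv_cancel_left g x.as).symm _

instance [Θ.functor.Full] [Θ.functor.Faithful] : Θ.catTilde.Full :=
  have := ((Functor.FullyFaithful.ofFullyFaithful Θ.functor).whiskeringRight (Codiscrete G)).full
  Functor.Full.of_iso Θ.whiskeringIsoCatTilde

instance [Θ.functor.Full] [Θ.functor.Faithful] : Θ.catTilde.Faithful :=
  have := ((Functor.FullyFaithful.ofFullyFaithful Θ.functor).whiskeringRight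
    (Codiscrete G)).faithful
  Functor.Faithful.of_iso Θ.whiskeringIsoCatTilde

/-! ### A strictly equivariant quasi-inverse on `Cat(G̃, -)`. -/

section Inverse

variable [Θ.functor.EssSurj]

/-- The object `x Θ⁻¹(x⁻¹ Z)`. -/
noncomputable def preObj (x : G) (Z : D) : C :=
  (act x).obj (Θ.functor.objPreimage ((act x⁻¹).obj Z))

/-- The objects `x⁻¹ (g Z)` and `h⁻¹ Z` are equal, so the same arbitrary preimage is chosen on both
sides. -/
theorem preObj_act {x g h : G} (hx : x = g * h) (Z : D) :
    Θ.preObj x ((act g).obj Z) = (act g).obj (Θ.preObj h Z) := by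
  rw [preObj, act_inv_act_obj hx, act_eq_act_act hx]; rfl

/-- The isomorphism `Θ(x Θ⁻¹(x⁻¹ Z)) ≅ Z`. -/
noncomputable def preIso (x : G) (Z : D) : Θ.functor.obj (Θ.preObj x Z) ≅ Z :=
  (Θ.θ x).app _ ≪≫ (act x).mapIso (Θ.functor.objObjPreimageIso ((act x⁻¹).obj Z)) ≪≫
    eqToIso (act_act_inv_obj x Z)

theorem preIso_act {x g h : G} (hx : x = g * h) (Z : D) :
    HEq ((Θ.θ g).hom.app (Θ.preObj h Z) ≫ (act g).map (Θ.preIso h Z).hom)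
      (Θ.preIso x ((act g).obj Z)).hom := by
  have key : ∀ (P : C) (V Z : D) (i : Θ.functor.obj P ≅ V) (e : (act h).obj V = Z),
      HEq ((Θ.θ g).hom.app ((act h).obj P) ≫ (act g).map ((Θ.θ h).hom.app P ≫
        (act h).map i.hom ≫ eqToHom e)) ((Θ.θ x).hom.app P ≫ (act x).map i.hom) := by
    rintro P V _ i rfl
    rw [eqToHom_refl, Category.comp_id, Functor.map_comp, ← Category.assoc]
    exact comp_heq (congrArg Θ.functor.obj (act_eq_act_act hx P).symm)
      (act_eq_act_act hx _).symm (act_eq_act_act hx _).symm (Θ.θ_mul_heq hx P).symm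
      (act_map_heq hx _).symm
  refine (key _ _ _ (Θ.functor.objObjPreimageIso ((act h⁻¹).obj Z))
    (act_act_inv_obj h Z)).trans ?_
  have e : (Θ.preIso x ((act g).obj Z)).hom =
      ((Θ.θ x).hom.app _ ≫ (act x).map (Θ.functor.objObjPreimageIso _).hom) ≫
        eqToHom (act_act_inv_obj x _) := by
    rw [Category.assoc]; rfl
  rw [e]
  refine HEq.trans ?_ (comp_eqToHom_heq _ _).symm
  exact (congr_arg_heq (fun V => (Θ.θ x).hom.app _ ≫
    (act x).map (Θ.functor.objObjPreimageIso V).hom) (act_inv_act_obj hx Z)).symm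

variable [Θ.functor.Full] [Θ.functor.Faithful]

/-- A preimage of an object of `Cat(G̃, D)` under `catTilde`, up to isomorphism. -/
noncomputable def catTildePreimage (Y : CatTilde G D) : CatTilde G C where
  obj x := Θ.preObj x.as (Y.obj x)
  map {x y} f := Θ.functor.preimage
    ((Θ.preIso x.as (Y.obj x)).hom ≫ Y.map f ≫ (Θ.preIso y.as (Y.obj y)).inv)
  map_id x := Θ.functor.map_injective (by simp)
  map_comp f g := Θ.functor.map_injective (by simp)

theorem catTildePreimage_act (g : G) (Y : CatTilde G D) :
    Θ.catTildePreimage ((act g).obj Y) = (act g).obj (Θ.catTildePreimage Y) := by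
  refine Functor.hext (fun x => Θ.preObj_act (mul_inv_cancel_left g x.as).symm _)
    fun x y f => ?_
  have hx := (mul_inv_cancel_left g x.as).symm
  have hy := (mul_inv_cancel_left g y.as).symm
  refine heq_of_map_heq Θ.functor (Θ.preObj_act hx _) (Θ.preObj_act hy _) ?_
  have e : ∀ {h k : G} {Z Z' : D} (f : Z ⟶ Z'), Θ.functor.map ((act g).map (Θ.functor.preimage
      ((Θ.preIso h Z).hom ≫ f ≫ (Θ.preIso k Z').inv))) =
      ((Θ.θ g).app _ ≪≫ (act g).mapIso (Θ.preIso h Z)).hom ≫ (act g).map f ≫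
        ((Θ.θ g).app _ ≪≫ (act g).mapIso (Θ.preIso k Z')).inv := by
    intro h k Z Z' f
    have := Θ.act_functor_map g (Θ.functor.preimage
      ((Θ.preIso h Z).hom ≫ f ≫ (Θ.preIso k Z').inv))
    rw [Θ.functor.map_preimage] at this
    rw [← cancel_epi ((Θ.θ g).inv.app _), ← cancel_mono ((Θ.θ g).hom.app _), Category.assoc]
    refine this.symm.trans ?_
    simp
  refine HEq.trans ?_ (heq_of_eq (e _).symm)
  refine (heq_of_eq (Θ.functor.map_preimage _)).trans ?_
  exact comp_heq (congrArg Θ.functor.obj (Θ.preObj_act hx _)) rfl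
    (congrArg Θ.functor.obj (Θ.preObj_act hy _)) (Θ.preIso_act hx _).symm
    (comp_heq rfl rfl (congrArg Θ.functor.obj (Θ.preObj_act hy _)) HEq.rfl
      (inv_heq (congrArg Θ.functor.obj (Θ.preObj_act hy _)) rfl (Θ.preIso_act hy _).symm))

theorem functor_map_catTildePreimage (Y : CatTilde G D) {x y : Codiscrete G} (f : x ⟶ y) :
    Θ.functor.map ((Θ.catTildePreimage Y).map f) =
      (Θ.preIso x.as (Y.obj x)).hom ≫ Y.map f ≫ (Θ.preIso y.as (Y.obj y)).inv :=
  Θ.functor.map_preimage _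

/-- `catTilde` maps `catTildePreimage` to an isomorphic object. -/
noncomputable def catTildePreimageIso (Y : CatTilde G D) :
    Θ.catTilde.obj (Θ.catTildePreimage Y) ≅ Y :=
  NatIso.ofComponents
    (fun x => (Θ.conjIso x.as _).symm ≪≫ Θ.preIso x.as (Y.obj x))
    (fun {x y} f => by
      have key : ∀ {A B A' B' Z Z' : D} (i : A ≅ A') (j : B ≅ B') (p : A ≅ Z) (q : B ≅ Z')
          (k : Z ⟶ Z') (m : A ⟶ B), m = p.hom ≫ k ≫ q.inv →
          (i.inv ≫ m ≫ j.hom) ≫ j.inv ≫ q.hom = (i.inv ≫ p.hom) ≫ k := by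
        rintro _ _ _ _ _ _ i j p q k _ rfl
        simp
      exact key _ _ _ _ _ _ (Θ.functor_map_catTildePreimage Y f))

/-- The isomorphism is `conjIso` inverted, followed by `preIso`. Acting by `g` and inserting `θ_g`
and its inverse between the two reduces the claim to `conjIso_act` and `preIso_act`. -/
theorem catTildePreimageIso_act (g : G) (Y : CatTilde G D) :
    HEq ((act g).map (Θ.catTildePreimageIso Y).hom)
      (Θ.catTildePreimageIso ((act g).obj Y)).hom := by
  have hΨ := Θ.catTildePreimage_act g Y
  refine natTrans_heq ?_ rfl _ _ fun x => ?_
  · rw [hΨ]; exact (Θ.catTilde_act_obj g _).symm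
  have hx : x.as = g * (g⁻¹ * x.as) := (mul_inv_cancel_left g x.as).symm
  have key : ∀ {y h : G} (_ : y = g * h) (Z : D),
      HEq ((act g).map ((Θ.conjIso h (Θ.preObj h Z)).inv ≫ (Θ.preIso h Z).hom))
        ((Θ.conjIso y (Θ.preObj y ((act g).obj Z))).inv ≫ (Θ.preIso y ((act g).obj Z)).hom) := by
    intro y h hy Z
    have e : (act g).map ((Θ.conjIso h (Θ.preObj h Z)).inv ≫ (Θ.preIso h Z).hom) =
        ((Θ.θ g).app _ ≪≫ (act g).mapIso (Θ.conjIso h (Θ.preObj h Z))).inv ≫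
          ((Θ.θ g).hom.app (Θ.preObj h Z) ≫ (act g).map (Θ.preIso h Z).hom) := by
      simp
    rw [e]
    have hp := Θ.preObj_act hy Z
    have hc := Θ.conjObj_act hy (Θ.preObj h Z)
    refine comp_heq (hc.symm.trans (congrArg (Θ.conjObj y) hp.symm))
      (congrArg Θ.functor.obj hp.symm) rfl ?_ (Θ.preIso_act hy Z)
    refine (inv_heq (e' := Θ.conjIso y ((act g).obj (Θ.preObj h Z))) rfl hc.symm
      (Θ.conjIso_act hy (Θ.preObj h Z))).trans ?_
    exact congr_arg_heq (fun P => (Θ.conjIso y P).inv) hp.symm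
  exact key hx _

/-- A pseudo equivariant equivalence induces an equivalence of `G`-categories on
`Cat(G̃, -)`. -/
noncomputable def catTildeEquivalence : GEquivalence G (CatTilde G C) (CatTilde G D) :=
  GEquivalence.ofFullyFaithful Θ.catTilde Θ.catTilde_equivariant Θ.catTildePreimage
    Θ.catTildePreimage_act Θ.catTildePreimageIso Θ.catTildePreimageIso_act

end Inverse

end PseudoEquivariantFunctor

/-! ## Monoidal pseudo equivariant functors -/

theorem tensorHom_heq {C : Type u₁} [Category.{v₁} C] [MonoidalCategory C] {X X' Y Y' Z Z' W W' : C}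
    (hX : X = X') (hY : Y = Y') (hZ : Z = Z') (hW : W = W') {f : X ⟶ Y} {f' : X' ⟶ Y'}
    {k : Z ⟶ W} {k' : Z' ⟶ W'} (hf : HEq f f') (hk : HEq k k') : HEq (f ⊗ₘ k) (f' ⊗ₘ k') := by
  subst hX hY hZ hW hf hk; rfl

namespace PseudoEquivariantFunctor

variable {G : Type w} [Group G] {C : Type u₁} [Category.{v₁} C] [MonoidalCategory C]
  [GCategory G C] [IsMonoidalGCategory G C]
  {D : Type u₂} [Category.{v₂} D] [MonoidalCategory D] [GCategory G D] [IsMonoidalGCategory G D]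
  (Θ : PseudoEquivariantFunctor G C D) [Θ.functor.Monoidal]

/-- The natural isomorphisms `θ_g` are compatible with tensor products. -/
def PreservesTensor : Prop :=
  ∀ (g : G) (X Y : C), Functor.LaxMonoidal.μ Θ.functor ((act g).obj X) ((act g).obj Y) ≫
    Θ.functor.map (eqToHom (IsMonoidalGCategory.act_tensorObj g X Y).symm) ≫
      (Θ.θ g).hom.app (X ⊗ Y) =
    ((Θ.θ g).hom.app X ⊗ₘ (Θ.θ g).hom.app Y) ≫
      eqToHom (IsMonoidalGCategory.act_tensorObj g _ _).symm ≫
        (act g).map (Functor.LaxMonoidal.μ Θ.functor X Y)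

noncomputable instance : Θ.catTilde.Monoidal := Functor.Monoidal.transport Θ.whiskeringIsoCatTilde

/-- The tensorator of `catTilde` at an object of `G̃`. -/
def conjμ (x : G) (Z Z' : C) : Θ.conjObj x Z ⊗ Θ.conjObj x Z' ⟶ Θ.conjObj x (Z ⊗ Z') :=
  ((Θ.conjIso x Z).inv ⊗ₘ (Θ.conjIso x Z').inv) ≫ Functor.LaxMonoidal.μ Θ.functor Z Z' ≫
    (Θ.conjIso x (Z ⊗ Z')).hom

variable {Θ}

/-- Acting by `g` leaves factors `θ_g` next to the tensorator of `Θ`. Compatibility of `θ_g` with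
tensor products moves them across, where they combine with `g` applied to `conjIso` at `h` to give
`conjIso` at `x`. -/
theorem conjμ_act (hΘ : Θ.PreservesTensor) {x g h : G} (hx : x = g * h) (Z Z' : C) :
    HEq ((act g).map (Θ.conjμ h Z Z')) (Θ.conjμ x ((act g).obj Z) ((act g).obj Z')) := by
  let A : ∀ Z : C, Θ.functor.obj ((act g).obj Z) ≅ (act g).obj (Θ.conjObj h Z) := fun Z =>
    (Θ.θ g).app Z ≪≫ (act g).mapIso (Θ.conjIso h Z)
  have hA : ∀ Z, HEq (A Z).hom (Θ.conjIso x ((act g).obj Z)).hom := fun Z => Θ.conjIso_act hx Z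
  have hc : ∀ Z, (act g).obj (Θ.conjObj h Z) = Θ.conjObj x ((act g).obj Z) := fun Z =>
    (Θ.conjObj_act hx Z).symm
  have hA' : ∀ Z, (act g).map (Θ.conjIso h Z).inv = (A Z).inv ≫ (Θ.θ g).hom.app Z := fun Z => by
    simp [A]
  have ht := (conj_eqToHom_iff_heq _ _ (IsMonoidalGCategory.act_tensorObj _ _ _)
    (IsMonoidalGCategory.act_tensorObj _ _ _)).2
    (IsMonoidalGCategory.act_tensorHom g (Θ.conjIso h Z).inv (Θ.conjIso h Z').inv)
  have e : (act g).map (Θ.conjμ h Z Z') =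
      eqToHom (IsMonoidalGCategory.act_tensorObj _ _ _) ≫ ((A Z).inv ⊗ₘ (A Z').inv) ≫
        Functor.LaxMonoidal.μ Θ.functor ((act g).obj Z) ((act g).obj Z') ≫
        Θ.functor.map (eqToHom (IsMonoidalGCategory.act_tensorObj g Z Z').symm) ≫
          (A (Z ⊗ Z')).hom := by
    have hΘ' := hΘ g Z Z'
    rw [conjμ, Functor.map_comp, ht, hA', hA', ← MonoidalCategory.tensorHom_comp_tensorHom]
    simp only [Category.assoc, Functor.map_comp]
    rw [← reassoc_of% hΘ']
    rfl
  rw [e]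
  refine (eqToHom_comp_heq _ _).trans ?_
  have hT := congrArg Θ.functor.obj (IsMonoidalGCategory.act_tensorObj g Z Z')
  have hco := (hc (Z ⊗ Z')).trans
    (congrArg (Θ.conjObj x) (IsMonoidalGCategory.act_tensorObj g Z Z'))
  refine comp_heq (by rw [hc, hc]) rfl hco
    (tensorHom_heq (hc Z) rfl (hc Z') rfl (inv_heq rfl (hc Z) (hA Z))
      (inv_heq rfl (hc Z') (hA Z'))) (comp_heq rfl rfl hco HEq.rfl ?_)
  rw [eqToHom_map]
  refine (eqToHom_comp_heq _ _).trans ((hA _).trans ?_)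
  exact congr_arg_heq (fun W => (Θ.conjIso x W).hom) (IsMonoidalGCategory.act_tensorObj g Z Z')

theorem catTilde_μ_act (hΘ : Θ.PreservesTensor) (g : G) (X Y : CatTilde G C) :
    HEq ((act g).map (Functor.LaxMonoidal.μ Θ.catTilde X Y))
      (Functor.LaxMonoidal.μ Θ.catTilde ((act g).obj X) ((act g).obj Y)) := by
  refine natTrans_heq ?_ ?_ _ _ fun x =>
    conjμ_act hΘ (mul_inv_cancel_left g x.as).symm _ _
  · rw [functor_act_tensorObj, catTilde_act_obj, catTilde_act_obj]
  · rw [← functor_act_tensorObj, catTilde_act_obj]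

end PseudoEquivariantFunctor

/-! ## Functoriality of `S⁻¹S` -/

namespace GroupCompletion

open Functor.LaxMonoidal Functor.Monoidal

section Map

variable {S : Type u₁} [Category.{v₁} S] [MonoidalCategory S]
  {T : Type u₂} [Category.{v₂} T] [MonoidalCategory T] (F : S ⥤ T) [F.Monoidal]

/-- The action of a monoidal functor on objects of `S⁻¹S`. -/
def mapObj (X : GroupCompletion S) : GroupCompletion T := ⟨F.obj X.fst, F.obj X.snd⟩

/-- The action of a monoidal functor on triples. -/
def mapTriple {X Y : GroupCompletion S} (a : Triple X Y) : Triple (mapObj F X) (mapObj F Y) :=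
  ⟨F.obj a.r, μ F a.r X.fst ≫ F.map a.f, μ F a.r X.snd ≫ F.map a.f'⟩

/-- The functor `S⁻¹S ⥤ T⁻¹T` induced by a monoidal functor `S ⥤ T`. -/
def map : GroupCompletion S ⥤ GroupCompletion T where
  obj := mapObj F
  map := Quotient.map (mapTriple F) (by
    rintro a b ⟨e, h, h'⟩
    refine ⟨F.mapIso e, ?_, ?_⟩
    · simp [mapTriple, mapObj, ← h]
    · simp [mapTriple, mapObj, ← h'])
  map_id X := by
    -- The functor `F` need not be strictly monoidal, but its unit and tensor comparisons are
    -- isomorphisms of first entries, which the relation on triples ignores.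
    refine Quotient.sound ⟨(εIso F).symm, ?_, ?_⟩ <;>
    · simp only [mapTriple, mapObj, Triple.id, left_unitality]
      simp
  map_comp := by
    rintro X Y Z ⟨a⟩ ⟨b⟩
    have key : ∀ (r m p s u : S) (f : r ⊗ m ⟶ p) (k : s ⊗ p ⟶ u),
        (μIso F s r).inv ▷ F.obj m ≫ (α_ (F.obj s) (F.obj r) (F.obj m)).hom ≫
          F.obj s ◁ (μ F r m ≫ F.map f) ≫ μ F s p ≫ F.map k =
        μ F (s ⊗ r) m ≫ F.map ((α_ s r m).hom ≫ s ◁ f ≫ k) := by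
      intro r m p s u f k
      rw [← cancel_epi ((μIso F s r).hom ▷ F.obj m), hom_inv_whiskerRight_assoc]
      simp
    exact Quotient.sound ⟨(μIso F b.r a.r).symm, key _ _ _ _ _ a.f b.f, key _ _ _ _ _ a.f' b.f'⟩

instance [F.Full] [F.Faithful] : (map F).Faithful where
  map_injective := by
    rintro X Y ⟨a⟩ ⟨b⟩ h
    obtain ⟨e, h₁, h₂⟩ : Triple.Rel (mapTriple F a) (mapTriple F b) := Quotient.exact h
    have key : ∀ (r s m p : S) (e : F.obj r ≅ F.obj s) (k : s ⊗ m ⟶ p) (f : r ⊗ m ⟶ p),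
        e.hom ▷ F.obj m ≫ μ F s m ≫ F.map k = μ F r m ≫ F.map f →
        (F.preimageIso e).hom ▷ m ≫ k = f := by
      intro r s m p e k f h
      refine F.map_injective ?_
      rw [← cancel_epi (μ F r m), ← h, F.map_comp, ← μ_natural_left_assoc]
      simp
    exact Quotient.sound ⟨F.preimageIso e, key _ _ _ _ e _ _ h₁, key _ _ _ _ e _ _ h₂⟩

/-- The first entry of a triple matters only up to isomorphism, so it may be taken in the image of
`F`; the two remaining morphisms then lift by fullness. -/
instance [F.Full] [F.EssSurj] : (map F).Full where
  map_surjective := by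
    rintro X Y ⟨b⟩
    let i := F.objObjPreimageIso b.r
    let r := F.objPreimage b.r
    let f : r ⊗ X.fst ⟶ Y.fst := F.preimage ((μIso F r X.fst).inv ≫ i.hom ▷ F.obj X.fst ≫ b.f)
    let f' : r ⊗ X.snd ⟶ Y.snd := F.preimage ((μIso F r X.snd).inv ≫ i.hom ▷ F.obj X.snd ≫ b.f')
    refine ⟨Quotient.mk _ ⟨r, f, f'⟩, Quotient.sound ⟨i, ?_, ?_⟩⟩
    · change i.hom ▷ F.obj X.fst ≫ b.f = (μIso F r X.fst).hom ≫ F.map f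
      rw [F.map_preimage, Iso.hom_inv_id_assoc]
      rfl
    · change i.hom ▷ F.obj X.snd ≫ b.f' = (μIso F r X.snd).hom ≫ F.map f'
      rw [F.map_preimage, Iso.hom_inv_id_assoc]
      rfl

/-- The morphism of `S⁻¹S` given by a pair of morphisms of `S`. -/
def homMk {X Y : GroupCompletion S} (f : X.fst ⟶ Y.fst) (f' : X.snd ⟶ Y.snd) : X ⟶ Y :=
  Quotient.mk _ (⟨𝟙_ S, (λ_ X.fst).hom ≫ f, (λ_ X.snd).hom ≫ f'⟩ : Triple X Y)

theorem homMk_comp {X Y Z : GroupCompletion S} (f : X.fst ⟶ Y.fst) (f' : X.snd ⟶ Y.snd)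
    (k : Y.fst ⟶ Z.fst) (k' : Y.snd ⟶ Z.snd) :
    homMk f f' ≫ homMk k k' = (homMk (f ≫ k) (f' ≫ k') : X ⟶ Z) := by
  refine Quotient.sound ⟨λ_ (𝟙_ S), ?_, ?_⟩ <;> simp [Triple.comp]

theorem homMk_id (X : GroupCompletion S) : homMk (𝟙 X.fst) (𝟙 X.snd) = 𝟙 X := by
  change Quotient.mk _ _ = Quotient.mk _ (Triple.id X)
  simp [Triple.id]

/-- The isomorphism of `S⁻¹S` given by a pair of isomorphisms of `S`. -/
def isoMk {X Y : GroupCompletion S} (e : X.fst ≅ Y.fst) (e' : X.snd ≅ Y.snd) : X ≅ Y where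
  hom := homMk e.hom e'.hom
  inv := homMk e.inv e'.inv
  hom_inv_id := by rw [homMk_comp, e.hom_inv_id, e'.hom_inv_id, homMk_id]
  inv_hom_id := by rw [homMk_comp, e.inv_hom_id, e'.inv_hom_id, homMk_id]

end Map

/-! ### Strict equivariance on `S⁻¹S`. -/

section Equivariance

variable {G : Type w} [Group G]
  {S : Type u₁} [Category.{v₁} S] [MonoidalCategory S] [GCategory G S] [IsMonoidalGCategory G S]
  {T : Type u₂} [Category.{v₂} T] [MonoidalCategory T] [GCategory G T] [IsMonoidalGCategory G T]

theorem map_equivariant (F : S ⥤ T) [F.Monoidal] (hF : IsEquivariant G F)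
    (hμ : ∀ (g : G) (X Y : S),
      HEq ((act g).map (μ F X Y)) (μ F ((act g).obj X) ((act g).obj Y))) :
    IsEquivariant G (map F) := by
  intro g
  have hFo : ∀ X : S, F.obj ((act g).obj X) = (act g).obj (F.obj X) := fun X =>
    Functor.congr_obj (hF g) X
  have ho : ∀ X : GroupCompletion S, mapObj F (actObj g X) = actObj g (mapObj F X) := fun X =>
    mk_eq (hFo _) (hFo _)
  have key : ∀ (r m p : S) (f : r ⊗ m ⟶ p),
      HEq (μ F ((act g).obj r) ((act g).obj m) ≫
          F.map (eqToHom (IsMonoidalGCategory.act_tensorObj g r m).symm ≫ (act g).map f))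
        (eqToHom (IsMonoidalGCategory.act_tensorObj g (F.obj r) (F.obj m)).symm ≫
          (act g).map (μ F r m ≫ F.map f)) := by
    intro r m p f
    refine HEq.trans ?_ (eqToHom_comp_heq _ _).symm
    rw [Functor.map_comp (act g)]
    have ht := IsMonoidalGCategory.act_tensorObj g r m
    refine comp_heq ?_ ?_ (hFo p) (hμ g r m).symm ?_
    · rw [hFo, hFo, IsMonoidalGCategory.act_tensorObj]
    · rw [← ht, hFo]
    · exact (map_heq F ht.symm rfl (eqToHom_comp_heq _ _)).trans (functor_map_heq (hF g) f)
  refine Functor.hext ho ?_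
  rintro X Y ⟨a⟩
  exact hom_heq (ho X) (ho Y) _ _ (hFo a.r) (key _ _ _ a.f) (key _ _ _ a.f')

theorem homMk_act (g : G) {X Y : GroupCompletion S} {X' Y' : GroupCompletion S}
    (hX : actObj g X = X') (hY : actObj g Y = Y') {f : X.fst ⟶ Y.fst} {f' : X.snd ⟶ Y.snd}
    {k : X'.fst ⟶ Y'.fst} {k' : X'.snd ⟶ Y'.snd} (hf : HEq ((act g).map f) k)
    (hf' : HEq ((act g).map f') k') : HEq ((act g).map (homMk f f')) (homMk k k') := by
  subst hX hY
  have key : ∀ {m p : S} (f : m ⟶ p),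
      HEq (eqToHom (IsMonoidalGCategory.act_tensorObj g (𝟙_ S) m).symm ≫
          (act g).map ((λ_ m).hom ≫ f)) ((λ_ ((act g).obj m)).hom ≫ (act g).map f) := by
    intro m p f
    refine (eqToHom_comp_heq _ _).trans ?_
    rw [Functor.map_comp]
    exact comp_heq (act_unit_tensor g m) rfl rfl (IsMonoidalGCategory.act_leftUnitor g m) HEq.rfl
  obtain rfl : (act g).map f = k := eq_of_heq hf
  obtain rfl : (act g).map f' = k' := eq_of_heq hf'
  exact hom_heq rfl rfl _ _ (IsMonoidalGCategory.act_tensorUnit g) (key f) (key f')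

/-- `S⁻¹S` of an equivalence of `G`-categories with an equivariant monoidal structure. -/
noncomputable def mapGEquivalence (E : GEquivalence G S T) [E.functor.Monoidal]
    (hμ : ∀ (g : G) (X Y : S), HEq ((act g).map (μ E.functor X Y))
      (μ E.functor ((act g).obj X) ((act g).obj Y))) :
    GEquivalence G (GroupCompletion S) (GroupCompletion T) :=
  have := E.isEquivalence_functor
  have hi : ∀ (g : G) (Y : T), E.inverse.obj ((act g).obj Y) = (act g).obj (E.inverse.obj Y) :=
    fun g => Functor.congr_obj (E.inverse_equivariant g)
  have hf : ∀ (g : G) (X : S), (act g).obj (E.functor.obj X) = E.functor.obj ((act g).obj X) :=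
    fun g X => (Functor.congr_obj (E.functor_equivariant g) X).symm
  GEquivalence.ofFullyFaithful (map E.functor) (map_equivariant E.functor E.functor_equivariant hμ)
    (fun Y => ⟨E.inverse.obj Y.fst, E.inverse.obj Y.snd⟩)
    (fun g Y => mk_eq (hi g Y.fst) (hi g Y.snd))
    (fun Y => isoMk (E.counit.app Y.fst) (E.counit.app Y.snd))
    (fun g Y => homMk_act g
      (mk_eq ((hf g _).trans (congrArg E.functor.obj (hi g Y.fst).symm))
        ((hf g _).trans (congrArg E.functor.obj (hi g Y.snd).symm))) rfl
      (E.act_counit g Y.fst) (E.act_counit g Y.snd))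

end Equivariance

end GroupCompletion

/-! ## Restriction of pseudo equivariant functors -/

section Restrict

universe v₃ u₃ v₄ u₄

variable {G : Type w} [Group G] {C : Type u₁} [Category.{v₁} C] [GCategory G C]
  {D : Type u₂} [Category.{v₂} D] [GCategory G D]
  {A : Type u₃} [Category.{v₃} A] {B : Type u₄} [Category.{v₄} B]

namespace PseudoEquivariantFunctor

variable (Θ : PseudoEquivariantFunctor G C D) {ι : A ⥤ C} {κ : B ⥤ D} {Ψ : A ⥤ B}

theorem restrict_source_obj [GCategory G A] (hι : IsEquivariant G ι)
    (hΨ : Ψ ⋙ κ = ι ⋙ Θ.functor) (g : G) (X : A) :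
    κ.obj (Ψ.obj ((act g).obj X)) = Θ.functor.obj ((act g).obj (ι.obj X)) :=
  (Functor.congr_obj hΨ _).trans (congrArg Θ.functor.obj (Functor.congr_obj (hι g) X))

theorem restrict_target_obj [GCategory G B] (hκ : IsEquivariant G κ)
    (hΨ : Ψ ⋙ κ = ι ⋙ Θ.functor) (g : G) (X : A) :
    κ.obj ((act g).obj (Ψ.obj X)) = (act g).obj (Θ.functor.obj (ι.obj X)) :=
  (Functor.congr_obj (hκ g) _).trans (congrArg (act g).obj (Functor.congr_obj hΨ X))

variable [GCategory G A] [GCategory G B] (hι : IsEquivariant G ι) (hκ : IsEquivariant G κ)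
  (hΨ : Ψ ⋙ κ = ι ⋙ Θ.functor)
  [κ.Full] [κ.Faithful]

/-- The natural isomorphisms `θ_g` of a restriction. -/
noncomputable def restrictθ (g : G) : act g ⋙ Ψ ≅ Ψ ⋙ act g :=
  ((Functor.FullyFaithful.ofFullyFaithful κ).whiskeringRight A).preimageIso
    (eqToIso (show (act g ⋙ Ψ) ⋙ κ = ι ⋙ act g ⋙ Θ.functor by
        rw [Functor.assoc, hΨ, ← Functor.assoc, hι g, Functor.assoc]) ≪≫
      Functor.isoWhiskerLeft ι (Θ.θ g) ≪≫
      eqToIso (show ι ⋙ Θ.functor ⋙ act g = (Ψ ⋙ act g) ⋙ κ by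
        rw [Functor.assoc, hκ g, ← Functor.assoc, ← hΨ, Functor.assoc]))

/-- Up to identifications of equal objects, the restricted isomorphism is `θ_g` itself; since `κ` is
faithful, both axioms for the restriction can be checked after applying `κ`. -/
theorem map_restrictθ_heq (g : G) (X : A) :
    HEq (κ.map ((Θ.restrictθ hι hκ hΨ g).hom.app X)) ((Θ.θ g).hom.app (ι.obj X)) := by
  have e := congrArg (fun t => t.app X)
    (((Functor.FullyFaithful.ofFullyFaithful κ).whiskeringRight A).map_preimage
      (eqToIso (show (act g ⋙ Ψ) ⋙ κ = ι ⋙ act g ⋙ Θ.functor by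
        rw [Functor.assoc, hΨ, ← Functor.assoc, hι g, Functor.assoc]) ≪≫
      Functor.isoWhiskerLeft ι (Θ.θ g) ≪≫
      eqToIso (show ι ⋙ Θ.functor ⋙ act g = (Ψ ⋙ act g) ⋙ κ by
        rw [Functor.assoc, hκ g, ← Functor.assoc, ← hΨ, Functor.assoc])).hom)
  refine (heq_of_eq e).trans ?_
  simp only [Iso.trans_hom, NatTrans.comp_app, eqToIso.hom, eqToHom_app]
  refine (eqToHom_comp_heq _ _).trans ((comp_eqToHom_heq _ _).trans ?_)
  rfl

/-- The restriction of a pseudo equivariant functor along fully faithful equivariant functors. -/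
noncomputable def restrict : PseudoEquivariantFunctor G A B where
  functor := Ψ
  θ := Θ.restrictθ hι hκ hΨ
  θ_one X := κ.map_injective (eq_of_heq (by
    refine (Θ.map_restrictθ_heq hι hκ hΨ 1 X).trans ?_
    rw [Θ.θ_one, eqToHom_map]
    have key : ∀ {X X' Y Y' : D} (_ : X = X') (h : X = Y) (h' : X' = Y'),
        HEq (eqToHom h) (eqToHom h') := by
      rintro _ _ _ _ rfl rfl rfl; rfl
    exact key (Θ.restrict_source_obj hι hΨ 1 X).symm _ _))
  θ_mul g h X := κ.map_injective (eq_of_heq (by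
    have e₁ := Θ.restrict_source_obj hι hΨ g ((act h).obj X)
    have e₂ := Θ.restrict_target_obj hκ hΨ h X
    have e₃ := Θ.restrict_target_obj hκ hΨ g ((act h).obj X)
    refine (Θ.map_restrictθ_heq hι hκ hΨ (g * h) X).trans
      ((Θ.θ_mul_heq rfl (ι.obj X)).trans ?_)
    simp only [Functor.map_comp, eqToHom_map]
    refine HEq.trans ?_ (eqToHom_comp_heq _ _).symm
    rw [← Category.assoc]
    refine HEq.trans ?_ (comp_eqToHom_heq _ _).symm
    have hX : ι.obj ((act h).obj X) = (act h).obj (ι.obj X) := Functor.congr_obj (hι h) X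
    have e₄ := (Functor.congr_obj hΨ ((act h).obj X)).trans (congrArg Θ.functor.obj hX)
    have e₅ := Functor.congr_obj (hκ g) ((act h).obj (Ψ.obj X))
    have e₆ := Functor.congr_obj (hκ g) (Ψ.obj ((act h).obj X))
    refine comp_heq (e₁.trans (congrArg (fun Z => Θ.functor.obj ((act g).obj Z)) hX)).symm
      (e₆.trans (congrArg (act g).obj e₄)).symm (e₅.trans (congrArg (act g).obj e₂)).symm ?_ ?_
    · exact (congr_arg_heq (fun Z => (Θ.θ g).hom.app Z) hX.symm).trans
        (Θ.map_restrictθ_heq hι hκ hΨ g _).symm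
    · refine HEq.trans ?_ (functor_map_heq (hκ g) _).symm
      exact map_heq (act g) e₄.symm e₂.symm (Θ.map_restrictθ_heq hι hκ hΨ h X).symm))

end PseudoEquivariantFunctor

end Restrict

/-! ### Categorical descriptions of finitely generated and of projective modules. -/

section Modules

variable {R : Type u} [Ring R] {S : Type u} [Ring S]

theorem isCompactElement_top_of_orderIso {α : Type u₁} {β : Type u₂} [PartialOrder α] [OrderTop α]
    [PartialOrder β] [OrderTop β] (e : α ≃o β) (h : IsCompactElement (⊤ : α)) :
    IsCompactElement (⊤ : β) := by
  intro s u hs hd hu hle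
  obtain ⟨x, ⟨y, hy, rfl⟩, hx⟩ := h (e.symm '' s) (e.symm u) (hs.image _)
    (by
      rintro _ ⟨a, ha, rfl⟩ _ ⟨b, hb, rfl⟩
      obtain ⟨c, hc, hac, hbc⟩ := hd a ha b hb
      exact ⟨_, ⟨c, hc, rfl⟩, e.symm.monotone hac, e.symm.monotone hbc⟩)
    (by simpa using hu) (by
      rw [← e.symm.map_top]; exact e.symm.monotone hle)
  exact ⟨y, hy, by rw [← e.map_top]; simpa using e.monotone hx⟩

/-- This expresses finite generation through the lattice of submodules, which is the lattice of
subobjects and therefore invariant under equivalence. -/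
theorem finite_iff_isCompactElement (M : ModuleCat.{v} R) :
    Module.Finite R M ↔ IsCompactElement (⊤ : Submodule R M) := by
  rw [Module.finite_def, Submodule.fg_iff_compact]

/-- Equivalences of module categories preserve finitely generated modules. -/
theorem finite_of_equivalence (e : ModuleCat.{v} R ≌ ModuleCat.{v} S) {M : ModuleCat.{v} R}
    (hM : Module.Finite R M) : Module.Finite S (e.functor.obj M) := by
  rw [finite_iff_isCompactElement] at hM ⊢
  exact isCompactElement_top_of_orderIso ((ModuleCat.subobjectModule M).symm.trans
    ((Subobject.lowerEquivalence (MonoOver.congr M e)).toOrderIso.trans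
      (ModuleCat.subobjectModule (e.functor.obj M)))) hM

theorem isFGProjective_of_equivalence (e : ModuleCat.{u} R ≌ ModuleCat.{u} S)
    {M : ModuleCat.{u} R} (hM : isFGProjective R M) : isFGProjective S (e.functor.obj M) :=
  ⟨finite_of_equivalence e hM.1, (IsProjective.iff_projective _).2
    ((e.map_projective_iff M).2 ((IsProjective.iff_projective M).1 hM.2))⟩

/-- The cokernel is a quotient of `N`, hence finitely generated, so the usual test against it is
available without leaving the category. -/
theorem surjective_of_epi_fgModuleCat {M N : FGModuleCat.{v} R} (f : M ⟶ N) [Epi f] :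
    Function.Surjective f.hom.hom := by
  have : Module.Finite R N.obj := N.property
  refine LinearMap.range_eq_top.1 (LinearMap.range_eq_top_of_cancel fun a b h => ?_)
  let p (c : N.obj →ₗ[R] N.obj ⧸ LinearMap.range f.hom.hom) :
      N ⟶ FGModuleCat.of R (N.obj ⧸ LinearMap.range f.hom.hom) :=
    ObjectProperty.homMk (ModuleCat.ofHom c)
  have hp : p a = p b := (cancel_epi f).1
    (ObjectProperty.hom_ext _ (ModuleCat.hom_ext h))
  exact congrArg (fun t => t.hom.hom) hp

/-- Epimorphisms here are surjective, which gives one direction. For the other, a finitely generated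
module is a quotient of some `Fin n → R`, which lies in the category, and the quotient map splits.
-/
theorem projective_iff_projective_fgModuleCat (M : FGModuleCat.{u} R) :
    Module.Projective R M.obj ↔ Projective M := by
  constructor
  · intro h
    refine ⟨fun {E X} f e he => ?_⟩
    obtain ⟨k, hk⟩ := Module.projective_lifting_property e.hom.hom f.hom.hom
      (surjective_of_epi_fgModuleCat e)
    exact ⟨ObjectProperty.homMk (ModuleCat.ofHom k), ObjectProperty.hom_ext _ (ModuleCat.hom_ext hk)⟩
  · intro h
    have : Module.Finite R M.obj := M.property
    obtain ⟨n, f, hf⟩ := Module.Finite.exists_fin' R M.obj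
    let p : FGModuleCat.of R (Fin n → R) ⟶ M := ObjectProperty.homMk (ModuleCat.ofHom f)
    have : Epi p := ⟨fun a b h => by
      ext x
      obtain ⟨y, rfl⟩ := hf x
      exact congrArg (fun t => t.hom.hom y) h⟩
    exact Module.Projective.of_split (Projective.factorThru (𝟙 M) p).hom.hom f
      (congrArg (fun t => t.hom.hom) (Projective.factorThru_comp (𝟙 M) p))

theorem projective_of_fgModuleCat_equivalence (e : FGModuleCat.{u} R ≌ FGModuleCat.{u} S)
    {M : FGModuleCat.{u} R} (hM : Module.Projective R M.obj) :
    Module.Projective S (e.functor.obj M).obj :=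
  (projective_iff_projective_fgModuleCat _).2
    ((e.map_projective_iff M).2 ((projective_iff_projective_fgModuleCat M).1 hM))

end Modules

/-! ## Cartesian monoidal `G`-categories -/

/-- `G` acts on a cartesian monoidal category through functors preserving the projections. -/
class PreservesProjections (G : Type w) [Group G] (C : Type u) [Category.{v} C]
    [CartesianMonoidalCategory C] [GCategory G C] [IsMonoidalGCategory G C] : Prop where
  act_fst : ∀ (g : G) (X Y : C), eqToHom (IsMonoidalGCategory.act_tensorObj g X Y).symm ≫
    (act g).map (CartesianMonoidalCategory.fst X Y) = CartesianMonoidalCategory.fst _ _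
  act_snd : ∀ (g : G) (X Y : C), eqToHom (IsMonoidalGCategory.act_tensorObj g X Y).symm ≫
    (act g).map (CartesianMonoidalCategory.snd X Y) = CartesianMonoidalCategory.snd _ _

namespace PseudoEquivariantFunctor

section Equivalence

variable {G : Type w} [Group G] {C : Type u₁} [Category.{v₁} C] [MonoidalCategory C]
  [GCategory G C] [IsMonoidalGCategory G C]
  {D : Type u₂} [Category.{v₂} D] [MonoidalCategory D] [GCategory G D] [IsMonoidalGCategory G D]
  (Θ : PseudoEquivariantFunctor G C D) [Θ.functor.Monoidal]
  [Θ.functor.EssSurj] [Θ.functor.Full] [Θ.functor.Faithful]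

noncomputable instance : Θ.catTildeEquivalence.functor.Monoidal :=
  inferInstanceAs Θ.catTilde.Monoidal

end Equivalence

/-! ### Products and the automatic compatibility of `θ` with tensor products. -/

section Cartesian

open CartesianMonoidalCategory Functor.LaxMonoidal

variable {G : Type w} [Group G] {C : Type u₁} [Category.{v₁} C] [CartesianMonoidalCategory C]
  [GCategory G C] {D : Type u₂} [Category.{v₂} D] [CartesianMonoidalCategory D] [GCategory G D]
  [IsMonoidalGCategory G D] [PreservesProjections G D]
  (Θ : PseudoEquivariantFunctor G C D) [Θ.functor.Monoidal]

/-- Both `Θ` and the action of `g` preserve products, so `g Θ(X ⊗ Y)` is a product with the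
displayed projections. -/
theorem act_functor_hom_ext (g : G) {X Y : C} {Z : D}
    {a b : Z ⟶ (act g).obj (Θ.functor.obj (X ⊗ Y))}
    (h₁ : a ≫ (act g).map (Θ.functor.map (fst X Y)) = b ≫ (act g).map (Θ.functor.map (fst X Y)))
    (h₂ : a ≫ (act g).map (Θ.functor.map (snd X Y)) = b ≫ (act g).map (Θ.functor.map (snd X Y))) :
    a = b := by
  have e₁ : (act g).map (Functor.Monoidal.μIso Θ.functor X Y).inv ≫
      eqToHom (IsMonoidalGCategory.act_tensorObj g _ _) ≫ fst _ _ =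
        (act g).map (Θ.functor.map (fst X Y)) := by
    rw [← PreservesProjections.act_fst, eqToHom_trans_assoc, eqToHom_refl, Category.id_comp,
      ← Functor.map_comp]
    simp
  have e₂ : (act g).map (Functor.Monoidal.μIso Θ.functor X Y).inv ≫
      eqToHom (IsMonoidalGCategory.act_tensorObj g _ _) ≫ snd _ _ =
        (act g).map (Θ.functor.map (snd X Y)) := by
    rw [← PreservesProjections.act_snd, eqToHom_trans_assoc, eqToHom_refl, Category.id_comp,
      ← Functor.map_comp]
    simp
  rw [← cancel_mono ((act g).map (Functor.Monoidal.μIso Θ.functor X Y).inv ≫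
    eqToHom (IsMonoidalGCategory.act_tensorObj g _ _))]
  refine hom_ext _ _ ?_ ?_
  · simp only [Category.assoc, e₁, h₁]
  · simp only [Category.assoc, e₂, h₂]

/-- Both sides map into a product, so they are compared on the two projections. There the identity
is naturality of `θ_g` at the projections of `X ⊗ Y`. -/
theorem preservesTensor_of_cartesian [IsMonoidalGCategory G C] [PreservesProjections G C] :
    Θ.PreservesTensor := by
  intro g X Y
  apply Θ.act_functor_hom_ext g
  · simp only [Category.assoc]
    have n := (Θ.θ g).hom.naturality (fst X Y)
    simp only [Functor.comp_map] at n
    rw [← n, ← Functor.map_comp_assoc, PreservesProjections.act_fst, ← Functor.map_comp,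
      Functor.Monoidal.μ_fst, PreservesProjections.act_fst, Functor.Monoidal.μ_fst_assoc]
    exact (tensorHom_fst _ _).symm
  · simp only [Category.assoc]
    have n := (Θ.θ g).hom.naturality (snd X Y)
    simp only [Functor.comp_map] at n
    rw [← n, ← Functor.map_comp_assoc, PreservesProjections.act_snd, ← Functor.map_comp,
      Functor.Monoidal.μ_snd, PreservesProjections.act_snd, Functor.Monoidal.μ_snd_assoc]
    exact (tensorHom_snd _ _).symm

end Cartesian

/-! ## Pseudo equivariant functors on maximal subgroupoids -/

section Core

variable {G : Type w} [Group G] {C : Type u₁} [Category.{v₁} C] [GCategory G C]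
  {D : Type u₂} [Category.{v₂} D] [GCategory G D] (Θ : PseudoEquivariantFunctor G C D)

theorem core_eqToHom_hom {X Y : Core C} (h : X = Y) :
    (eqToHom h).iso.hom = eqToHom (congrArg Core.of h) := by
  subst h; rfl

/-- The restriction of a pseudo equivariant functor to maximal subgroupoids. -/
def core : PseudoEquivariantFunctor G (Core C) (Core D) where
  functor := Θ.functor.core
  θ g := (Θ.θ g).core
  θ_one X := Core.hom_ext ((Θ.θ_one X.of).trans (core_eqToHom_hom _).symm)
  θ_mul g h X := Core.hom_ext ((Θ.θ_mul g h X.of).trans (by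
    simp only [coreCategory_comp_iso, Iso.trans_hom, core_eqToHom_hom]
    rfl))

instance [Θ.functor.IsEquivalence] : Θ.core.functor.IsEquivalence :=
  Θ.functor.asEquivalence.core.isEquivalence_functor

end Core

/-! ### Monoidal structures on maximal subgroupoids. -/

section MonoidalCore

variable {C : Type u₁} [Category.{v₁} C] [MonoidalCategory C]
  {D : Type u₂} [Category.{v₂} D] [MonoidalCategory D]

open Functor.LaxMonoidal

instance coreFunctorMonoidal (F : C ⥤ D) [F.Monoidal] : F.core.Monoidal :=
  Functor.CoreMonoidal.toMonoidal
    { εIso := Core.isoMk (Functor.Monoidal.εIso F)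
      μIso := fun X Y => Core.isoMk (Functor.Monoidal.μIso F X.of Y.of)
      μIso_hom_natural_left := fun f X => Core.hom_ext (μ_natural_left F f.iso.hom X.of)
      μIso_hom_natural_right := fun X f => Core.hom_ext (μ_natural_right F X.of f.iso.hom)
      associativity := fun X Y Z => Core.hom_ext (associativity F X.of Y.of Z.of)
      left_unitality := fun X => Core.hom_ext (left_unitality F X.of)
      right_unitality := fun X => Core.hom_ext (right_unitality F X.of) }

variable {G : Type w} [Group G] [GCategory G C] [IsMonoidalGCategory G C] [GCategory G D]
  [IsMonoidalGCategory G D] (Θ : PseudoEquivariantFunctor G C D) [Θ.functor.Monoidal]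

instance : Θ.core.functor.Monoidal := coreFunctorMonoidal Θ.functor

variable {Θ}

theorem preservesTensor_core (hΘ : Θ.PreservesTensor) : Θ.core.PreservesTensor := fun g X Y =>
  Core.hom_ext (by
    have h := hΘ g X.of Y.of
    refine Eq.trans ?_ (h.trans ?_)
    · have e := core_eqToHom_hom (IsMonoidalGCategory.act_tensorObj g X Y).symm
      exact congrArg (fun t => μ Θ.functor _ _ ≫ Θ.functor.map t ≫ (Θ.θ g).hom.app _) e
    · have e := core_eqToHom_hom
        (IsMonoidalGCategory.act_tensorObj g (Θ.core.functor.obj X) (Θ.core.functor.obj Y)).symm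
      exact congrArg (fun t => ((Θ.θ g).hom.app X.of ⊗ₘ (Θ.θ g).hom.app Y.of) ≫ t ≫
        (act g).map (μ Θ.functor X.of Y.of)) e.symm)

end MonoidalCore

end PseudoEquivariantFunctor

/-! ## Equivariant Morita equivalence -/

noncomputable instance projCartesianMonoidalCategory (R : Type u) [Ring R] :
    CartesianMonoidalCategory (ProjModuleCat.{v} R) where
  isTerminalTensorUnit := Limits.IsTerminal.ofUniqueHom
    (fun _ => ObjectProperty.homMk (ModuleCat.ofHom 0))
    (fun _ _ => ObjectProperty.hom_ext _ (ModuleCat.hom_ext (LinearMap.ext fun _ => rfl)))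
  fst M N := ObjectProperty.homMk (ModuleCat.ofHom (LinearMap.fst R M.obj N.obj))
  snd M N := ObjectProperty.homMk (ModuleCat.ofHom (LinearMap.snd R M.obj N.obj))
  fst_def _ _ := rfl
  snd_def _ _ := rfl
  tensorProductIsBinaryProduct _ _ := Limits.BinaryFan.isLimitMk
    (fun s => ObjectProperty.homMk (ModuleCat.ofHom (s.fst.hom.hom.prod s.snd.hom.hom)))
    (fun _ => rfl) (fun _ => rfl)
    (fun _ _ h₁ h₂ => ObjectProperty.hom_ext _ (ModuleCat.hom_ext (LinearMap.ext fun x =>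
      Prod.ext (congrArg (fun t => t.hom.hom x) h₁) (congrArg (fun t => t.hom.hom x) h₂))))

instance (G : Type w) [Group G] (R : Type u) [Ring R] [MulSemiringAction G R] :
    PreservesProjections G (ProjModuleCat.{v} R) where
  act_fst _ _ _ := rfl
  act_snd _ _ _ := rfl

section Morita

variable {G : Type w} [Group G] {R S : Type u} [Ring R] [Ring S] [MulSemiringAction G R]
  [MulSemiringAction G S]

/-- Finite generation and projectivity are preserved by `Θ` and by its inverse, so `Θ` restricts to
an equivalence of the full subcategories. -/
theorem EquivariantlyMoritaEquivalent.exists_projModuleCat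
    (h : EquivariantlyMoritaEquivalent G R S) :
    ∃ Θ : PseudoEquivariantFunctor G (ProjModuleCat.{u} R) (ProjModuleCat.{u} S),
      Θ.functor.IsEquivalence := by
  obtain ⟨Θ, hΘ⟩ := h
  let e := Θ.functor.asEquivalence
  let Ψ : ProjModuleCat.{u} R ⥤ ProjModuleCat.{u} S :=
    (isFGProjective S).lift ((isFGProjective R).ι ⋙ Θ.functor)
      (fun X => isFGProjective_of_equivalence e X.property)
  have hΨ : Ψ.IsEquivalence :=
    { full := Functor.Full.of_comp_faithful_iso (G := (isFGProjective S).ι)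
        (H := (isFGProjective R).ι ⋙ Θ.functor) (Iso.refl _)
      faithful := Functor.Faithful.of_comp_iso (G := (isFGProjective S).ι)
        (H := (isFGProjective R).ι ⋙ Θ.functor) (Iso.refl _)
      essSurj := ⟨fun Y => ⟨⟨e.inverse.obj Y.obj, isFGProjective_of_equivalence e.symm Y.property⟩,
        ⟨(isFGProjective S).isoMk (e.counitIso.app Y.obj)⟩⟩⟩ }
  exact ⟨Θ.restrict (ι := (isFGProjective R).ι) (κ := (isFGProjective S).ι) (Ψ := Ψ)
    (fun _ => rfl) (fun _ => rfl) rfl, hΨ⟩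

/-- The inclusion of finitely generated projective modules into finitely generated modules. -/
def projToFG (R : Type u) [Ring R] : ProjModuleCat.{v} R ⥤ FGModuleCat.{v} R :=
  (ModuleCat.isFG R).lift (isFGProjective R).ι (fun X => X.property.1)

instance (R : Type u) [Ring R] : (projToFG.{v} R).Full :=
  Functor.Full.of_comp_faithful_iso (G := (ModuleCat.isFG R).ι) (H := (isFGProjective R).ι)
    (Iso.refl _)

instance (R : Type u) [Ring R] : (projToFG.{v} R).Faithful :=
  Functor.Faithful.of_comp_iso (G := (ModuleCat.isFG R).ι) (H := (isFGProjective R).ι)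
    (Iso.refl _)

/-- A lift of a functor to finitely generated modules with projective values. -/
def liftFG {A : Type u₁} [Category.{v₁} A] (F : A ⥤ FGModuleCat.{v} R)
    (hF : ∀ X, Module.Projective R (F.obj X).obj) : A ⥤ ProjModuleCat.{v} R :=
  (isFGProjective R).lift (F ⋙ (ModuleCat.isFG R).ι) (fun X => ⟨(F.obj X).property, hF X⟩)

theorem FGEquivariantlyMoritaEquivalent.exists_projModuleCat
    (h : FGEquivariantlyMoritaEquivalent G R S) :
    ∃ Θ : PseudoEquivariantFunctor G (ProjModuleCat.{u} R) (ProjModuleCat.{u} S),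
      Θ.functor.IsEquivalence := by
  obtain ⟨Θ, hΘ⟩ := h
  let e := Θ.functor.asEquivalence
  have hproj (X : ProjModuleCat.{u} R) :
      Module.Projective S ((projToFG R ⋙ Θ.functor).obj X).obj :=
    projective_of_fgModuleCat_equivalence e (M := (projToFG R).obj X) X.property.2
  let Ψ : ProjModuleCat.{u} R ⥤ ProjModuleCat.{u} S := liftFG (projToFG R ⋙ Θ.functor) hproj
  have hΨ : Ψ.IsEquivalence :=
    { full := Functor.Full.of_comp_faithful_iso (G := projToFG S)
        (H := projToFG R ⋙ Θ.functor) (Iso.refl _)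
      faithful := Functor.Faithful.of_comp_iso (G := projToFG S)
        (H := projToFG R ⋙ Θ.functor) (Iso.refl _)
      essSurj := ⟨fun Y =>
        -- Finite generation of the preimage is part of its type here; only projectivity has to be
        -- transferred along the inverse equivalence.
        let Z : FGModuleCat.{u} R := e.inverse.obj ((projToFG S).obj Y)
        ⟨⟨Z.obj, Z.property, projective_of_fgModuleCat_equivalence e.symm
          (M := (projToFG S).obj Y) Y.property.2⟩,
        ⟨(isFGProjective S).isoMk
          ((ModuleCat.isFG S).ι.mapIso (e.counitIso.app ((projToFG S).obj Y)))⟩⟩⟩ }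
  exact ⟨Θ.restrict (ι := projToFG R) (κ := projToFG S) (Ψ := Ψ)
    (fun _ => rfl) (fun _ => rfl) rfl, hΨ⟩

end Morita

end EquivariantK

theorem mainTheorem12 {G : Type w} [Group G] {R S : Type u} [Ring R] [Ring S]
    [MulSemiringAction G R] [MulSemiringAction G S]
    (h : EquivariantK.EquivariantlyMoritaEquivalent G R S ∨
      EquivariantK.FGEquivariantlyMoritaEquivalent G R S) :
    (∃ (F : EquivariantK.CatTilde G (EquivariantK.ProjModuleCat.{u} R) ⥤
          EquivariantK.CatTilde G (EquivariantK.ProjModuleCat.{u} S))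
        (hF : EquivariantK.IsEquivariant G F),
      EquivariantK.IsWeakGEquivalence G (EquivariantK.classifyingMap F) ∧
      ∀ H : Subgroup G, (EquivariantK.fixedFunctor F hF H).IsEquivalence) ∧
    Nonempty (EquivariantK.GHomotopyEquiv G
      (EquivariantK.KSpace G R) (EquivariantK.KSpace G S)) := by
  obtain ⟨Θ, _⟩ : ∃ Θ : EquivariantK.PseudoEquivariantFunctor G
      (EquivariantK.ProjModuleCat.{u} R) (EquivariantK.ProjModuleCat.{u} S),
      Θ.functor.IsEquivalence :=
    h.elim (fun h => h.exists_projModuleCat) (fun h => h.exists_projModuleCat)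
  refine ⟨⟨Θ.catTilde, Θ.catTilde_equivariant, Θ.catTildeEquivalence.gHomotopyEquiv.isWeakGEquivalence,
    Θ.catTildeEquivalence.isEquivalence_fixedFunctor⟩, ?_⟩
  -- An equivalence preserves finite products. The compatibility of `θ` with `⊕` is established
  -- before passing to isomorphism groupoids, since the projections used to prove it are not
  -- isomorphisms in general.
  let _ : Θ.functor.Monoidal := Functor.Monoidal.ofChosenFiniteProducts Θ.functor
  have hΘ := EquivariantK.PseudoEquivariantFunctor.preservesTensor_core
    Θ.preservesTensor_of_cartesian
  exact ⟨(EquivariantK.GroupCompletion.mapGEquivalence Θ.core.catTildeEquivalence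
    (EquivariantK.PseudoEquivariantFunctor.catTilde_μ_act hΘ)).gHomotopyEquiv⟩
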